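/- Let $T>0$, let $f$ be a real locally integrable function on $\mathbb{R}^d$ or the white noise kernel $f=\delta$ (Dirac distribution at $0$), and suppose that $f$ is the Fourier transform of a measure $\mu$ on $\mathbb{R}^d$, i.e. $f(x)=\int_{\mathbb{R}^d}e^{-i\xi\cdot x}\mu(d\xi)$ in the sense of distributions, where $$\int_{\mathbb{R}^d}\frac{1}{1+|\xi|^2}\,\mu(d\xi)<\infty .$$ Write $\mathcal{D}=\mathcal{D}((0,T)\times\mathbb{R}^d)$ for the space of real, compactly supported smooth functions on $(0,T)\times\mathbb{R}^d$. Let $F=\{F(\varphi);\varphi\in\mathcal{D}\}$ be a zero-mean Gaussian process on a probability space $(\Omega,\mathcal{A},P)$ with covariance $$E(F(\varphi)F(\psi))=\langle\varphi,\psi\rangle_0=\int_0^T\int_{\mathbb{R}^d}\int_{\mathbb{R}^d}\varphi(t,x)f(x-y)\psi(t,y)\,dy\,dx\,dt$$ (which reads $\int_0^T\int_{\mathbb{R}^d}\varphi(t,x)\psi(t,x)\,dx\,dt$ if $f=\delta$). Let $\|\varphi\|_0^2=\int_0^T\int_{\mathbb{R}^d}|\mathcal{F}\varphi(t,\xi)|^2\mu(d\xi)\,dt$,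 where $\mathcal{F}\varphi(t,\xi)=\int_{\mathbb{R}^d} e^{-i\xi\cdot x}\varphi(t,x)\,dx$ is the Fourier transform in space, and let $M(\varphi)=\int_0^T\int_{\mathbb{R}^d}\varphi(t,x)\,M(dt,dx)$ be the stochastic integral with respect to the noise, i.e. the extension by $L_2(\Omega)$-continuity with respect to $\|\cdot\|_0$ of $M(\varphi)=F(\varphi)$, $\varphi\in\mathcal{D}$. Let $G(t,x)=(4\pi t)^{-d/2}\exp(-|x|^2/(4t))$ for $t>0$ and $G(t,x)=0$ for $t\le 0$, and let $$u(t,x)=\int_0^T\int_{\mathbb{R}^d}G(t-s,x-y)\,M(ds,dy),\qquad t\in[0,T],\ x\in\mathbb{R}^d,$$ be the process solution of the stochastic heat equation $u_t-\Delta u=\dot F$ in $(0,T)\times\mathbb{R}^d$, $u(0,\cdot)=0$. Then $H^u=H^F$, where $H^u$ is the closed linear subspace of $L_2(\Omega)$ generated by $\{u(t,x);\,t\in[0,T],\,x\in\mathbb{R}^d\}$, and $H^F$ is the closed linear subspace of $L_2(\Omega)$ generated by $\{F(\varphi);\,\varphi\in\mathcal{D}\}$. -/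

import Mathlib

open MeasureTheory ProbabilityTheory Set Filter Topology
open scoped ENNReal Distributions

noncomputable section

namespace StochHeat

/-- Euclidean space `ℝ^d`. -/
abbrev Space (d : ℕ) : Type := EuclideanSpace ℝ (Fin d)

/-- The open time-space region `(0,T) × ℝ^d`. -/
def region (T : ℝ) (d : ℕ) : TopologicalSpace.Opens (ℝ × Space d) :=
  ⟨Ioo 0 T ×ˢ univ, isOpen_Ioo.prod isOpen_univ⟩

/-- A spatial covariance kernel: a locally integrable function `f` on `ℝ^d`, or the white noise
kernel `f = δ` (Dirac distribution at the origin). -/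
inductive Kernel (d : ℕ) : Type
  | ofFun (f : Space d → ℝ) (hf : LocallyIntegrable f) : Kernel d
  | whiteNoise : Kernel d

/-- The kernel as a distribution on `ℝ^d`: `χ ↦ ∫ f(x) χ(x) dx`, respectively `χ ↦ χ(0)`. -/
def Kernel.pairing {d : ℕ} : Kernel d → (Space d → ℝ) → ℝ
  | .ofFun f _, χ => ∫ x, f x * χ x
  | .whiteNoise, χ => χ 0

/-- `⟨φ, ψ⟩₀ = ∫₀ᵀ ∫ ∫ φ(t,x) f(x-y) ψ(t,y) dy dx dt`; for `f = δ` this is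
`∫₀ᵀ ∫ φ(t,x) ψ(t,x) dx dt`. -/
def Kernel.covariance {d : ℕ} (T : ℝ) : Kernel d → (φ ψ : ℝ × Space d → ℝ) → ℝ
  | .ofFun f _, φ, ψ => ∫ t in Ioo 0 T, ∫ x, ∫ y, φ (t, x) * f (x - y) * ψ (t, y)
  | .whiteNoise, φ, ψ => ∫ t in Ioo 0 T, ∫ x, φ (t, x) * ψ (t, x)

/-- The Fourier transform `∫ exp(-i ξ·x) χ(x) dx` of a real function on `ℝ^d`. -/
def fourier {d : ℕ} (χ : Space d → ℝ) (ξ : Space d) : ℂ :=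
  ∫ x, Complex.exp (-(Complex.I * ((inner ℝ ξ x : ℝ) : ℂ))) * (χ x : ℂ)

/-- `μ` is the spectral measure of the kernel: `f(x) = ∫ exp(-i ξ·x) μ(dξ)` in the sense of
distributions, that is, `f(χ) = ∫ (∫ exp(-i ξ·x) χ(x) dx) μ(dξ)` for all `χ ∈ 𝓓(ℝ^d)`. -/
def IsSpectralMeasure {d : ℕ} (κ : Kernel d) (μ : Measure (Space d)) : Prop :=
  ∀ χ : 𝓓((⊤ : TopologicalSpace.Opens (Space d)), ℝ),
    ((κ.pairing χ : ℝ) : ℂ) = ∫ ξ, fourier χ ξ ∂μ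

section Noise

variable {Ω : Type*} [MeasurableSpace Ω] {d : ℕ}

/-- `F = {F(φ); φ ∈ 𝓓((0,T) × ℝ^d)}` is a zero-mean Gaussian process with covariance
`E(F(φ) F(ψ)) = ⟨φ, ψ⟩₀`. -/
structure IsGaussianNoise (T : ℝ) (κ : Kernel d) (P : Measure Ω)
    (F : 𝓓(region T d, ℝ) → Ω → ℝ) : Prop where
  isGaussianProcess : IsGaussianProcess F P
  mean_zero : ∀ φ, ∫ ω, F φ ω ∂P = 0
  covariance : ∀ φ ψ, ∫ ω, F φ ω * F ψ ω ∂P = κ.covariance T φ ψ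

variable {T : ℝ} {κ : Kernel d} {P : Measure Ω} {F : 𝓓(region T d, ℝ) → Ω → ℝ}

/-- The variable `F(φ)` as an element of `L₂(Ω)`. -/
def IsGaussianNoise.toL2 (hF : IsGaussianNoise T κ P F) (φ : 𝓓(region T d, ℝ)) : Lp ℝ 2 P :=
  (hF.isGaussianProcess.hasGaussianLaw_eval φ).memLp_two.toLp (F φ)

/-- The Gaussian space `H^F`: the closed linear subspace of `L₂(Ω)` generated by the variables
`F(φ)`, `φ ∈ 𝓓((0,T) × ℝ^d)`. -/
def noiseGaussianSpace (hF : IsGaussianNoise T κ P F) : Submodule ℝ (Lp ℝ 2 P) :=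
  (Submodule.span ℝ (range hF.toL2)).topologicalClosure

/-- `∫₀ᵀ ∫ |h(t,ξ) - k(t,ξ)|² μ(dξ) dt`. This is `‖φ - ψ‖₀²` if `h` and `k` are the Fourier
transforms in space of the integrands `φ` and `ψ`. -/
def distSq (T : ℝ) (μ : Measure (Space d)) (h k : ℝ → Space d → ℂ) : ℝ≥0∞ :=
  ∫⁻ t in Ioo 0 T, ∫⁻ ξ, ‖h t ξ - k t ξ‖ₑ ^ 2 ∂μ

/-- The stochastic integral `M(φ)` of a deterministic integrand `φ`, a function or a distribution
in the space variable, that is given through its Fourier transform in space `h(t,ξ) = 𝓕φ(t,ξ)`.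
It is the extension by continuity of `M(ψ) = F(ψ)`, `ψ ∈ 𝓓((0,T) × ℝ^d)`: the limit in `L₂(Ω)`
of `F(ψ)` as `ψ` runs through `𝓓((0,T) × ℝ^d)` with `‖ψ - φ‖₀ → 0`. -/
def stochIntegral (hF : IsGaussianNoise T κ P F) (μ : Measure (Space d))
    (h : ℝ → Space d → ℂ) : Lp ℝ 2 P :=
  limUnder
    (comap (fun ψ : 𝓓(region T d, ℝ) => distSq T μ (fun t => fourier fun x => ψ (t, x)) h) (𝓝 0))
    hF.toL2

/-- The fundamental solution `G(t,x)` of the heat equation. -/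
def heatKernel (t : ℝ) (x : Space d) : ℝ :=
  if 0 < t then (4 * Real.pi * t) ^ (-(d : ℝ) / 2) * Real.exp (-‖x‖ ^ 2 / (4 * t)) else 0

/-- The process solution `u(t,x) = M(g)` with `g(s,y) = G(t-s,x-y)`. -/
def processSolution (hF : IsGaussianNoise T κ P F) (μ : Measure (Space d))
    (t : ℝ) (x : Space d) : Lp ℝ 2 P :=
  stochIntegral hF μ (fun s => fourier fun y => heatKernel (t - s) (x - y))

/-- The Gaussian space `H^u`: the closed linear subspace of `L₂(Ω)` generated by the variables
`u(t,x)`, `t ∈ [0,T]`, `x ∈ ℝ^d`. -/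
def solutionGaussianSpace (hF : IsGaussianNoise T κ P F) (μ : Measure (Space d)) :
    Submodule ℝ (Lp ℝ 2 P) :=
  (Submodule.span ℝ
    {Y | ∃ t ∈ Icc 0 T, ∃ x : Space d, Y = processSolution hF μ t x}).topologicalClosure

end Noise

end StochHeat

end

/-! Sending `F(φ)` to the spatial Fourier transform `φ̂` preserves inner products, because `⟨φ,ψ⟩₀`
is the integral of `Re (φ̂ · conj ψ̂)` against `dt μ(dξ)` (`covariance_eq_inner`). This embeds the
noise in `L²((0,T) × ℝ^d, dt μ(dξ); ℂ)`, regarded as a real Hilbert space. There `u(t,x)` is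
represented by `1_{s<t} exp(-iξ·x) exp(-(t-s)|ξ|²)`, which is square integrable because its squared
modulus integrates in time to at most `(T+1)/(1+|ξ|²)`. Membership in a closed span depends only on
the Gram matrix (`mem_closure_span_of_gram`), so both inclusions can be proved on the Fourier side.

`H^u ⊆ H^F`: the heat kernel, cut off in time away from `s = 0` and from the singularity `s = t`,
and cut off in space, is a test function. Removing the cutoffs by dominated convergence gives
`heatFourier_mem_closure`.

`H^F ⊆ H^u`: with `w = -∂ₜφ - Δφ`, Duhamel's formula for the backward heat equation reads `φ(s,y) =
∫∫ w(t,x) G(t-s,x-y) dx dt`, so `F(φ)` is a superposition of the `u(t,x)`. This is used in dual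
form: by Fubini, a vector orthogonal to every representation of `u(t,x)` is orthogonal to `φ̂`
(`spectralRep_mem_closure_span`). -/

noncomputable section

namespace StochHeat

/-! ### Families of vectors with equal Gram matrices. -/

section Gram

variable {ι X Y : Type*} [NormedAddCommGroup X] [InnerProductSpace ℝ X]
  [NormedAddCommGroup Y] [InnerProductSpace ℝ Y] {a : ι → X} {b : ι → Y}

/-- Families with the same Gram matrix have linear combinations of the same norm. -/
theorem norm_linearCombination_eq_of_gram (h : ∀ i j, inner ℝ (a i) (a j) = inner ℝ (b i) (b j))
    (l : ι →₀ ℝ) :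
    ‖Finsupp.linearCombination ℝ a l‖ = ‖Finsupp.linearCombination ℝ b l‖ := by
  rw [← sq_eq_sq₀ (norm_nonneg _) (norm_nonneg _), ← real_inner_self_eq_norm_sq,
    ← real_inner_self_eq_norm_sq]
  simp only [Finsupp.linearCombination_apply, Finsupp.sum, sum_inner, inner_sum,
    real_inner_smul_left, real_inner_smul_right, h]

theorem norm_sub_eq_of_gram (h : ∀ i j, inner ℝ (a i) (a j) = inner ℝ (b i) (b j)) (i j : ι) :
    ‖a i - a j‖ = ‖b i - b j‖ := by
  have := norm_linearCombination_eq_of_gram h (Finsupp.single i 1 - Finsupp.single j 1)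
  simpa only [map_sub, Finsupp.linearCombination_single, one_smul] using this

/-- Membership in the closed span of a subfamily depends only on the Gram matrix. -/
theorem mem_closure_span_of_gram (h : ∀ i j, inner ℝ (a i) (a j) = inner ℝ (b i) (b j))
    {i : ι} {S : Set ι} (hi : a i ∈ (Submodule.span ℝ (a '' S)).topologicalClosure) :
    b i ∈ (Submodule.span ℝ (b '' S)).topologicalClosure := by
  rw [← SetLike.mem_coe, Submodule.topologicalClosure_coe, Metric.mem_closure_iff] at hi ⊢
  intro ε hε
  obtain ⟨x, hx, hxε⟩ := hi ε hε
  obtain ⟨l, hl, rfl⟩ := (Finsupp.mem_span_image_iff_linearCombination ℝ).1 hx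
  refine ⟨Finsupp.linearCombination ℝ b l,
    (Finsupp.mem_span_image_iff_linearCombination ℝ).2 ⟨l, hl, rfl⟩, ?_⟩
  have := norm_linearCombination_eq_of_gram h (Finsupp.single i 1 - l)
  simp only [map_sub, Finsupp.linearCombination_single, one_smul] at this
  rwa [dist_eq_norm, ← this, ← dist_eq_norm]

/-- The extension by continuity of `a i ↦ b i` to a limit point `g` of the family `a`. -/
theorem exists_seq_tendsto_limUnder_of_gram [CompleteSpace Y]
    (h : ∀ i j, inner ℝ (a i) (a j) = inner ℝ (b i) (b j)) {g : X} (hg : g ∈ closure (range a))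
    [Nonempty Y] {D : ι → ℝ≥0∞} (hD : ∀ i, D i = edist (a i) g ^ 2) :
    ∃ u : ℕ → ι, Tendsto (fun n => a (u n)) atTop (𝓝 g) ∧
      Tendsto (fun n => b (u n)) atTop (𝓝 (limUnder (comap D (𝓝 0)) b)) := by
  obtain ⟨x, hx, hxg⟩ := mem_closure_iff_seq_limit.1 hg
  choose u hu using hx
  obtain rfl : (fun n => a (u n)) = x := funext hu
  have hDu : Tendsto (fun n => D (u n)) atTop (𝓝 0) := by
    have h0 := ENNReal.Tendsto.pow (n := 2) (tendsto_iff_edist_tendsto_0.1 hxg)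
    simpa [hD] using h0
  have hcau : CauchySeq fun n => b (u n) := by
    have := hxg.cauchySeq
    rw [Metric.cauchySeq_iff] at this ⊢
    simpa only [dist_eq_norm, norm_sub_eq_of_gram h] using this
  obtain ⟨y, hy⟩ := cauchySeq_tendsto_of_complete hcau
  -- The isometry survives in the limit, so `D i` is also the squared distance from `b i` to `y`;
  -- hence `b` converges along the whole filter, not only along `u`.
  have hnorm : ∀ i, dist (b i) y = dist (a i) g := fun i => by
    refine tendsto_nhds_unique (tendsto_const_nhds.dist hy) ?_
    simpa only [dist_eq_norm, norm_sub_eq_of_gram h] using (tendsto_const_nhds (x := a i)).dist hxg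
  -- Without this `limUnder` would not be determined by convergence; it is where the density of the
  -- family near `g` enters.
  have hne : (comap D (𝓝 0)).NeBot :=
    comap_neBot fun t ht => ((hDu.eventually ht).exists).imp' u fun _ hn => hn
  have hlim : Tendsto b (comap D (𝓝 0)) (𝓝 y) := by
    rw [tendsto_iff_edist_tendsto_0]
    have h1 : Tendsto (fun i => D i ^ (1 / 2 : ℝ)) (comap D (𝓝 0)) (𝓝 0) := by
      have := (ENNReal.continuous_rpow_const (y := 1 / 2)).tendsto 0
      simp only [one_div, inv_pos, Nat.ofNat_pos, ENNReal.zero_rpow_of_pos] at this ⊢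
      exact this.comp tendsto_comap
    refine h1.congr fun i => ?_
    rw [hD, ← ENNReal.rpow_natCast, ← ENNReal.rpow_mul, edist_dist, edist_dist, hnorm]
    norm_num
  exact ⟨u, hxg, by rwa [hlim.limUnder_eq]⟩

end Gram

/-! ### Fourier transform of real functions on space. -/

section Fourier

variable {d : ℕ}

/-- The character `x ↦ exp(-i ξ·x)`. -/
def char (ξ x : Space d) : ℂ := Complex.exp (-(Complex.I * ((inner ℝ ξ x : ℝ) : ℂ)))

theorem norm_char (ξ x : Space d) : ‖char ξ x‖ = 1 := by
  simp [char, Complex.norm_exp]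

theorem continuous_char : Continuous fun p : Space d × Space d => char p.1 p.2 := by
  unfold char; fun_prop

theorem continuous_char_right (ξ : Space d) : Continuous (char ξ) := by
  unfold char; fun_prop

theorem char_add (ξ x y : Space d) : char ξ (x + y) = char ξ x * char ξ y := by
  rw [char, char, char, ← Complex.exp_add, inner_add_right]; push_cast; ring_nf

theorem char_neg (ξ x : Space d) : char ξ (-x) = (starRingEnd ℂ) (char ξ x) := by
  rw [char, char, ← Complex.exp_conj, inner_neg_right]; simp

theorem fourier_eq (χ : Space d → ℝ) (ξ : Space d) :
    fourier χ ξ = ∫ x, char ξ x * (χ x : ℂ) := rfl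

theorem hasFDerivAt_char (ξ x : Space d) :
    HasFDerivAt (char ξ) (char ξ x • (-(Complex.I • Complex.ofRealCLM.comp (innerSL ℝ ξ)))) x := by
  have h : HasFDerivAt (fun x => -(Complex.I * ((inner ℝ ξ x : ℝ) : ℂ)))
      (-(Complex.I • Complex.ofRealCLM.comp (innerSL ℝ ξ))) x :=
    (((Complex.ofRealCLM.comp (innerSL ℝ ξ)).hasFDerivAt).const_mul Complex.I).neg
  exact h.cexp

theorem norm_char_mul (χ : Space d → ℝ) (ξ x : Space d) : ‖char ξ x * (χ x : ℂ)‖ = ‖χ x‖ := by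
  rw [norm_mul, norm_char, one_mul, Complex.norm_real]

theorem integrable_char_mul {χ : Space d → ℝ} (hχ : Integrable χ) (ξ : Space d) :
    Integrable fun x => char ξ x * (χ x : ℂ) := by
  refine hχ.mono ?_ (.of_forall fun x => (norm_char_mul χ ξ x).le)
  exact (continuous_char_right ξ).aestronglyMeasurable.mul hχ.ofReal.aestronglyMeasurable

theorem norm_fourier_le (χ : Space d → ℝ) (ξ : Space d) : ‖fourier χ ξ‖ ≤ ∫ x, ‖χ x‖ := by
  rw [fourier_eq]
  refine (norm_integral_le_integral_norm _).trans_eq ?_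
  simp only [norm_char_mul]

theorem fourier_add {χ η : Space d → ℝ} (hχ : Integrable χ) (hη : Integrable η) (ξ : Space d) :
    fourier (fun x => χ x + η x) ξ = fourier χ ξ + fourier η ξ := by
  simp only [fourier_eq, Complex.ofReal_add, mul_add]
  exact integral_add (integrable_char_mul hχ ξ) (integrable_char_mul hη ξ)

theorem fourier_const_mul (c : ℝ) (χ : Space d → ℝ) (ξ : Space d) :
    fourier (fun x => c * χ x) ξ = c * fourier χ ξ := by
  simp only [fourier_eq, Complex.ofReal_mul, ← integral_const_mul]
  congr! 2; ring

theorem fourier_neg (χ : Space d → ℝ) (ξ : Space d) :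
    fourier (fun x => -χ x) ξ = -fourier χ ξ := by
  simpa using fourier_const_mul (-1) χ ξ

theorem fourier_sum {ι : Type*} (s : Finset ι) {χ : ι → Space d → ℝ}
    (hχ : ∀ i ∈ s, Integrable (χ i)) (ξ : Space d) :
    fourier (fun x => ∑ i ∈ s, χ i x) ξ = ∑ i ∈ s, fourier (χ i) ξ := by
  simp only [fourier_eq, Complex.ofReal_sum, Finset.mul_sum]
  exact integral_finsetSum s fun i hi => integrable_char_mul (hχ i hi) ξ

/-- The Fourier transform of a directional derivative. -/
theorem fourier_fderiv {χ : Space d → ℝ} (hχ : ContDiff ℝ 1 χ) (hc : HasCompactSupport χ)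
    (v ξ : Space d) :
    fourier (fun x => fderiv ℝ χ x v) ξ = Complex.I * (inner ℝ ξ v : ℝ) * fourier χ ξ := by
  have hd : ∀ x, HasFDerivAt (fun x => (χ x : ℂ)) (Complex.ofRealCLM.comp (fderiv ℝ χ x)) x :=
    fun x => Complex.ofRealCLM.hasFDerivAt.comp x
      (hχ.differentiable one_ne_zero x).hasFDerivAt
  have hint : Integrable χ := hχ.continuous.integrable_of_hasCompactSupport hc
  have hint' : Integrable fun x => fderiv ℝ χ x v :=
    ((hχ.continuous_fderiv one_ne_zero).clm_apply continuous_const).integrable_of_hasCompactSupport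
      (hc.fderiv_apply ℝ v)
  have e1 : ∀ x, fderiv ℝ (char ξ) x v = -(Complex.I * (inner ℝ ξ v : ℝ)) * char ξ x := fun x => by
    rw [(hasFDerivAt_char ξ x).fderiv]; simp; ring
  have e2 : ∀ x, fderiv ℝ (fun x => (χ x : ℂ)) x v = (fderiv ℝ χ x v : ℝ) := fun x => by
    rw [(hd x).fderiv]; rfl
  have key := integral_mul_fderiv_eq_neg_fderiv_mul_of_integrable (μ := volume) (f := char ξ)
    (g := fun x => (χ x : ℂ)) (v := v) ?_ ?_ (integrable_char_mul hint ξ)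
    (fun x _ => (hasFDerivAt_char ξ x).differentiableAt) (fun x _ => (hd x).differentiableAt)
  · simp only [e1, e2, mul_assoc, integral_const_mul] at key
    rw [fourier_eq, key, fourier_eq]
    ring
  · simp only [e1, mul_assoc]
    exact (integrable_char_mul hint ξ).const_mul _
  · simpa only [e2] using integrable_char_mul hint' ξ

/-- Decay of the Fourier transform of a `C¹` function. -/
theorem norm_fourier_sq_le {χ : Space d → ℝ} (hχ : ContDiff ℝ 1 χ) (hc : HasCompactSupport χ)
    {A B : ℝ} (hA : ∫ x, ‖χ x‖ ≤ A) (hB : ∫ x, ‖fderiv ℝ χ x‖ ≤ B) (ξ : Space d) :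
    ‖fourier χ ξ‖ ^ 2 ≤ (A ^ 2 + B ^ 2) * (1 / (1 + ‖ξ‖ ^ 2)) := by
  have h0 : ‖fourier χ ξ‖ ≤ A := (norm_fourier_le χ ξ).trans hA
  have h1 : ‖ξ‖ * ‖fourier χ ξ‖ ≤ B := by
    rcases eq_or_ne ξ 0 with rfl | hξ
    · simpa using (integral_nonneg fun x => norm_nonneg _).trans hB
    -- Differentiating in the direction `ξ` itself makes the Fourier multiplier `i|ξ|²`.
    have h2 : ‖ξ‖ ^ 2 * ‖fourier χ ξ‖ ≤ ‖ξ‖ * B := by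
      have h3 := norm_fourier_le (fun x => fderiv ℝ χ x ξ) ξ
      rw [fourier_fderiv hχ hc, real_inner_self_eq_norm_sq] at h3
      simp only [norm_mul, Complex.norm_I, one_mul, Complex.norm_real, norm_pow, norm_norm] at h3
      refine h3.trans ?_
      calc ∫ x, ‖fderiv ℝ χ x ξ‖ ≤ ∫ x, ‖ξ‖ * ‖fderiv ℝ χ x‖ := by
            refine integral_mono_of_nonneg (.of_forall fun x => norm_nonneg _) ?_
              (.of_forall fun x => ?_)
            · exact ((hχ.continuous_fderiv one_ne_zero).norm.integrable_of_hasCompactSupport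
                (hc.fderiv ℝ).norm).const_mul _
            · exact ((fderiv ℝ χ x).le_opNorm ξ).trans_eq (mul_comm _ _)
        _ ≤ ‖ξ‖ * B := by
            rw [integral_const_mul]; gcongr
    have hpos : 0 < ‖ξ‖ := norm_pos_iff.2 hξ
    rw [sq, mul_assoc] at h2
    exact le_of_mul_le_mul_left h2 hpos
  rw [mul_one_div, le_div_iff₀ (by positivity), mul_add, mul_one, ← mul_pow]
  gcongr
  rwa [mul_comm]

end Fourier

/-! ### Correlation of spatial test functions. -/

section Correlation

variable {d : ℕ}

/-- The correlation `z ↦ ∫ φ(x) ψ(x - z) dx`. -/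
def correlation (φ ψ : Space d → ℝ) (z : Space d) : ℝ := ∫ x, φ x * ψ (x - z)

theorem correlation_eq_convolution (φ ψ : Space d → ℝ) :
    correlation φ ψ = convolution φ (fun x => ψ (-x)) (ContinuousLinearMap.lsmul ℝ ℝ) volume := by
  ext z
  simp [correlation, convolution]

theorem hasCompactSupport_comp_neg {ψ : Space d → ℝ} (hψ : HasCompactSupport ψ) :
    HasCompactSupport fun x => ψ (-x) :=
  hψ.comp_homeomorph (Homeomorph.neg _)

theorem contDiff_correlation {φ ψ : Space d → ℝ} (hφ : Continuous φ)
    (hψ : ContDiff ℝ ((⊤ : ℕ∞) : WithTop ℕ∞) ψ) (hψc : HasCompactSupport ψ) :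
    ContDiff ℝ ((⊤ : ℕ∞) : WithTop ℕ∞) (correlation φ ψ) := by
  rw [correlation_eq_convolution]
  exact (hasCompactSupport_comp_neg hψc).contDiff_convolution_right _ hφ.locallyIntegrable
    (hψ.comp contDiff_neg)

theorem hasCompactSupport_correlation {φ ψ : Space d → ℝ} (hφc : HasCompactSupport φ)
    (hψc : HasCompactSupport ψ) : HasCompactSupport (correlation φ ψ) := by
  rw [correlation_eq_convolution]
  exact hφc.convolution _ (hasCompactSupport_comp_neg hψc)

theorem integrable_prod_correlation {φ ψ : Space d → ℝ} (hφ : Integrable φ) (hψ : Integrable ψ) :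
    Integrable fun p : Space d × Space d => φ p.2 * ψ (p.2 - p.1) := by
  have h := Integrable.convolution_integrand (ContinuousLinearMap.lsmul ℝ ℝ)
    (μ := volume) (ν := volume) hφ hψ.comp_neg
  simp only [neg_sub] at h
  exact h

/-- Fubini and the substitution `y = x - z`, which splits the character as `char ξ x` times the
conjugate of `char ξ y`. -/
theorem fourier_correlation {φ ψ : Space d → ℝ} (hφ : Integrable φ) (hψ : Integrable ψ)
    (ξ : Space d) :
    fourier (correlation φ ψ) ξ = fourier φ ξ * (starRingEnd ℂ) (fourier ψ ξ) := by
  have hint : Integrable fun p : Space d × Space d =>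
      char ξ p.1 * ((φ p.2 * ψ (p.2 - p.1) : ℝ) : ℂ) := by
    refine (integrable_prod_correlation hφ hψ).mono ?_ (.of_forall fun p => ?_)
    · exact ((continuous_char_right ξ).comp continuous_fst).aestronglyMeasurable.mul
        (integrable_prod_correlation hφ hψ).ofReal.aestronglyMeasurable
    · rw [norm_mul, norm_char, one_mul, Complex.norm_real]
  calc fourier (correlation φ ψ) ξ
      = ∫ z, ∫ x, char ξ z * ((φ x * ψ (x - z) : ℝ) : ℂ) := by
        rw [fourier_eq]
        refine integral_congr_ae (.of_forall fun z => ?_)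
        simp only [correlation]
        rw [← integral_complex_ofReal, ← integral_const_mul]
    _ = ∫ x, ∫ z, char ξ z * ((φ x * ψ (x - z) : ℝ) : ℂ) := integral_integral_swap hint
    _ = ∫ x, char ξ x * (φ x : ℂ) * (starRingEnd ℂ) (fourier ψ ξ) := by
        refine integral_congr_ae (.of_forall fun x => ?_)
        simp only
        rw [fourier_eq, ← integral_conj, ← integral_const_mul,
          ← integral_sub_left_eq_self (fun z => char ξ z * ((φ x * ψ (x - z) : ℝ) : ℂ)) volume x]
        refine integral_congr_ae (.of_forall fun y => ?_)
        simp only [sub_sub_cancel]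
        simp only [map_mul, Complex.conj_ofReal, ← char_neg, sub_eq_add_neg, char_add,
          Complex.ofReal_mul]
        ring
    _ = _ := by rw [integral_mul_const, ← fourier_eq]

/-- The covariance of two spatial test functions is the kernel paired with their correlation. -/
theorem integral_kernel_eq_pairing {f : Space d → ℝ} (hf : LocallyIntegrable f)
    {φ ψ : Space d → ℝ} (hφ : Continuous φ) (hφc : HasCompactSupport φ)
    (hψ : Continuous ψ) (hψc : HasCompactSupport ψ) :
    ∫ x, ∫ y, φ x * f (x - y) * ψ y = ∫ z, f z * correlation φ ψ z := by
  have hφi : Integrable φ := hφ.integrable_of_hasCompactSupport hφc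
  -- Only `z` in the compact difference set of the supports contribute, so the locally integrable
  -- `f` may be replaced by an integrable function before applying Fubini.
  set K : Set (Space d) := (fun p : Space d × Space d => p.1 - p.2) '' (tsupport φ ×ˢ tsupport ψ)
  have hKc : IsCompact K := (hφc.isCompact.prod hψc.isCompact).image (by fun_prop)
  have hfK : Integrable (K.indicator f) :=
    (integrable_indicator_iff hKc.measurableSet).2 (hf.integrableOn_isCompact hKc)
  have hind : ∀ x z, φ x * f z * ψ (x - z) = φ x * K.indicator f z * ψ (x - z) := by
    intro x z
    by_cases hz : z ∈ K
    · rw [indicator_of_mem hz]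
    · by_cases hx : φ x = 0
      · simp [hx]
      by_cases hy : ψ (x - z) = 0
      · simp [hy]
      exact absurd ⟨(x, x - z), ⟨subset_tsupport φ hx, subset_tsupport ψ hy⟩, by simp⟩ hz
  obtain ⟨C, hC⟩ := hψ.bounded_above_of_compact_support hψc
  have hint : Integrable fun p : Space d × Space d => φ p.1 * f p.2 * ψ (p.1 - p.2) := by
    simp only [hind]
    exact (hφi.mul_prod hfK).mul_bdd (c := C)
      (hψ.comp (continuous_fst.sub continuous_snd)).aestronglyMeasurable
      (.of_forall fun p => hC _)
  calc ∫ x, ∫ y, φ x * f (x - y) * ψ y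
      = ∫ x, ∫ z, φ x * f z * ψ (x - z) := by
        refine integral_congr_ae (.of_forall fun x => ?_)
        simp only
        rw [← integral_sub_left_eq_self (fun y => φ x * f (x - y) * ψ y) volume x]
        simp only [sub_sub_cancel]
    _ = ∫ z, ∫ x, φ x * f z * ψ (x - z) := integral_integral_swap hint
    _ = _ := by
        refine integral_congr_ae (.of_forall fun z => ?_)
        simp only [correlation, ← integral_const_mul]
        congr! 2; ring

end Correlation

/-! ### Inner products and dominated convergence in `L²`. -/

section LTwo

variable {α : Type*} [MeasurableSpace α] {ν : Measure α}

theorem inner_toLp_toLp {E : Type*} [NormedAddCommGroup E] [InnerProductSpace ℝ E] {f g : α → E}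
    (hf : MemLp f 2 ν) (hg : MemLp g 2 ν) :
    inner ℝ (hf.toLp f) (hg.toLp g) = ∫ a, inner ℝ (f a) (g a) ∂ν := by
  rw [L2.inner_def]
  refine integral_congr_ae ?_
  filter_upwards [hf.coeFn_toLp, hg.coeFn_toLp] with a h1 h2
  rw [h1, h2]

theorem norm_sq_toLp {f : α → ℂ} (hf : MemLp f 2 ν) : ‖hf.toLp f‖ ^ 2 = ∫ a, ‖f a‖ ^ 2 ∂ν := by
  rw [← real_inner_self_eq_norm_sq, inner_toLp_toLp]
  simp only [real_inner_self_eq_norm_sq]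

theorem memLp_two_of_sq_le {f : α → ℂ} (hf : AEStronglyMeasurable f ν) {g : α → ℝ}
    (hg : Integrable g ν) (hfg : ∀ a, ‖f a‖ ^ 2 ≤ g a) : MemLp f 2 ν := by
  rw [memLp_two_iff_integrable_sq_norm hf]
  exact hg.mono' (hf.norm.pow 2) (.of_forall fun a => by simpa using hfg a)

/-- Dominated convergence in `L²`. -/
theorem tendsto_toLp_of_dominated {f : ℕ → α → ℂ} {k : α → ℂ} (hf : ∀ n, MemLp (f n) 2 ν)
    (hk : MemLp k 2 ν) {g : α → ℝ} (hg : Integrable g ν) (hfg : ∀ n a, ‖f n a‖ ^ 2 ≤ g a)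
    (hlim : ∀ᵐ a ∂ν, Tendsto (fun n => f n a) atTop (𝓝 (k a))) :
    Tendsto (fun n => (hf n).toLp (f n)) atTop (𝓝 (hk.toLp k)) := by
  rw [tendsto_iff_norm_sub_tendsto_zero]
  have h : Tendsto (fun n => ∫ a, ‖f n a - k a‖ ^ 2 ∂ν) atTop (𝓝 (∫ _, (0 : ℝ) ∂ν)) := by
    have hk2 := (memLp_two_iff_integrable_sq_norm hk.1).1 hk
    refine tendsto_integral_of_dominated_convergence (fun a => 2 * (g a + ‖k a‖ ^ 2))
      (fun n => ((hf n).1.sub hk.1).norm.pow 2) ((hg.add hk2).const_mul 2)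
      (fun n => .of_forall fun a => ?_) ?_
    · rw [norm_pow, norm_norm]
      have := norm_sub_le (f n a) (k a)
      calc ‖f n a - k a‖ ^ 2 ≤ (‖f n a‖ + ‖k a‖) ^ 2 := by gcongr
        _ ≤ 2 * (‖f n a‖ ^ 2 + ‖k a‖ ^ 2) := add_sq_le
        _ ≤ _ := by gcongr; exact hfg n a
    · filter_upwards [hlim] with a ha
      simpa using ((tendsto_iff_norm_sub_tendsto_zero.1 ha).pow 2)
  have h2 := (Real.continuous_sqrt.tendsto _).comp h
  simp only [integral_zero, Real.sqrt_zero] at h2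
  refine h2.congr fun n => ?_
  rw [Function.comp_apply, ← MemLp.toLp_sub, ← Real.sqrt_sq (norm_nonneg (MemLp.toLp _ _)),
    norm_sq_toLp]
  rfl

end LTwo

/-! ### The spectral measure on time-space. -/

section Spectral

variable {d : ℕ} {μ : Measure (Space d)} {T : ℝ}

/-- The weight `ξ ↦ 1 / (1 + |ξ|²)`. -/
def weight (ξ : Space d) : ℝ := 1 / (1 + ‖ξ‖ ^ 2)

theorem weight_pos (ξ : Space d) : 0 < weight ξ := by unfold weight; positivity

theorem continuous_weight : Continuous (weight : Space d → ℝ) := by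
  unfold weight
  exact continuous_const.div (by fun_prop) fun ξ => by positivity

/-- An integrable function vanishes off a σ-finite set, and the weight vanishes nowhere. This is
what permits Fubini with `μ`, which may be infinite. -/
theorem sigmaFinite_of_integrable_weight (hμ : Integrable weight μ) : SigmaFinite μ := by
  obtain ⟨t, -, ht, hs⟩ := ((memLp_one_iff_integrable.2
    hμ).finStronglyMeasurable_of_stronglyMeasurable continuous_weight.stronglyMeasurable
    one_ne_zero ENNReal.one_ne_top).exists_set_sigmaFinite
  have : t = univ := eq_univ_of_forall fun ξ => by
    by_contra h
    exact (weight_pos ξ).ne' (ht ξ h)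
  rwa [this, Measure.restrict_univ] at hs

/-- The measure `dt μ(dξ)` on `(0,T) × ℝ^d`. -/
def spectralProd (T : ℝ) (μ : Measure (Space d)) : Measure (ℝ × Space d) :=
  (volume.restrict (Ioo 0 T)).prod μ

instance [SFinite μ] : SFinite (spectralProd T μ) := by unfold spectralProd; infer_instance

theorem integrable_weight_snd [SFinite μ] (hμ : Integrable weight μ) :
    Integrable (fun p : ℝ × Space d => weight p.2) (spectralProd T μ) :=
  hμ.comp_snd _

theorem ae_spectralProd_fst_mem [SFinite μ] : ∀ᵐ p ∂spectralProd T μ, p.1 ∈ Ioo 0 T :=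
  Measure.quasiMeasurePreserving_fst.ae (ae_restrict_mem measurableSet_Ioo)

/-- The Fourier transform in space of a function on time-space. -/
def spaceFourier (φ : ℝ × Space d → ℝ) (p : ℝ × Space d) : ℂ := fourier (fun x => φ (p.1, x)) p.2

theorem stronglyMeasurable_spaceFourier {φ : ℝ × Space d → ℝ} (hφ : StronglyMeasurable φ) :
    StronglyMeasurable (spaceFourier φ) := by
  have h : StronglyMeasurable fun q : (ℝ × Space d) × Space d =>
      char q.1.2 q.2 * (φ (q.1.1, q.2) : ℂ) := by
    refine StronglyMeasurable.mul ?_ ?_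
    · exact (continuous_char.comp ((continuous_snd.comp continuous_fst).prodMk
        continuous_snd)).stronglyMeasurable
    · exact Complex.continuous_ofReal.comp_stronglyMeasurable
        (hφ.comp_measurable (by fun_prop))
  exact h.integral_prod_right'

end Spectral

/-! ### Time slices of test functions, with bounds uniform in time. -/

section Slice

variable {d : ℕ} {φ : ℝ × Space d → ℝ}

theorem hasCompactSupport_slice {E : Type*} [Zero E] {φ : ℝ × Space d → E}
    (hφ : HasCompactSupport φ) (t : ℝ) : HasCompactSupport fun x => φ (t, x) := by
  refine HasCompactSupport.of_support_subset_isCompact (hφ.isCompact.image continuous_snd) ?_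
  exact fun x hx => ⟨(t, x), subset_tsupport φ hx, rfl⟩

theorem contDiff_slice {n : WithTop ℕ∞} (hφ : ContDiff ℝ n φ) (t : ℝ) :
    ContDiff ℝ n fun x => φ (t, x) :=
  hφ.comp (contDiff_const.prodMk contDiff_id)

theorem integrable_slice (hφ : Continuous φ) (hc : HasCompactSupport φ) (t : ℝ) :
    Integrable fun x => φ (t, x) :=
  (hφ.comp (by fun_prop)).integrable_of_hasCompactSupport (hasCompactSupport_slice hc t)

theorem hasFDerivAt_slice (hφ : Differentiable ℝ φ) (t : ℝ) (x : Space d) :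
    HasFDerivAt (fun x => φ (t, x))
      ((fderiv ℝ φ (t, x)).comp (ContinuousLinearMap.inr ℝ ℝ (Space d))) x :=
  (hφ (t, x)).hasFDerivAt.comp x (hasFDerivAt_prodMk_right t x)

/-- All slices are bounded by one constant and supported in the compact projection of the support to
space. -/
theorem exists_integral_norm_slice_le {E : Type*} [NormedAddCommGroup E] {φ : ℝ × Space d → E}
    (hφ : Continuous φ) (hc : HasCompactSupport φ) : ∃ A, ∀ t, ∫ x, ‖φ (t, x)‖ ≤ A := by
  obtain ⟨C, hC⟩ := hφ.bounded_above_of_compact_support hc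
  set K := Prod.snd '' tsupport φ with hK
  have hKc : IsCompact K := hc.isCompact.image continuous_snd
  have hint : Integrable (K.indicator fun _ => C) :=
    (integrable_indicator_iff hKc.measurableSet).2 (integrableOn_const hKc.measure_lt_top.ne)
  refine ⟨∫ x, K.indicator (fun _ => C) x, fun t => integral_mono_of_nonneg
    (.of_forall fun x => norm_nonneg _) hint (.of_forall fun x => ?_)⟩
  by_cases hx : x ∈ K
  · simpa [indicator_of_mem hx] using hC (t, x)
  · have : φ (t, x) = 0 := by
      by_contra h
      exact hx ⟨(t, x), subset_tsupport φ h, rfl⟩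
    simp [indicator_of_notMem hx, this]

theorem exists_norm_spaceFourier_sq_le (hφ : ContDiff ℝ 1 φ) (hc : HasCompactSupport φ) :
    ∃ C, ∀ p, ‖spaceFourier φ p‖ ^ 2 ≤ C * weight p.2 := by
  obtain ⟨A, hA⟩ := exists_integral_norm_slice_le hφ.continuous hc
  obtain ⟨B, hB⟩ := exists_integral_norm_slice_le (hφ.continuous_fderiv one_ne_zero) (hc.fderiv ℝ)
  refine ⟨A ^ 2 + B ^ 2, fun p => norm_fourier_sq_le (contDiff_slice hφ p.1)
    (hasCompactSupport_slice hc p.1) (hA p.1) ((integral_mono_of_nonneg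
      (.of_forall fun x => norm_nonneg _) ?_ (.of_forall fun x => ?_)).trans (hB p.1)) p.2⟩
  · exact ((hφ.continuous_fderiv one_ne_zero).comp
      (by fun_prop : Continuous fun x => (p.1, x))).norm.integrable_of_hasCompactSupport
      (hasCompactSupport_slice (hc.fderiv ℝ) p.1).norm
  · simp only
    rw [(hasFDerivAt_slice (hφ.differentiable one_ne_zero) p.1 x).fderiv]
    refine (ContinuousLinearMap.opNorm_comp_le _ _).trans ?_
    exact mul_le_of_le_one_right (norm_nonneg _) (ContinuousLinearMap.norm_inr_le_one ..)

variable {μ : Measure (Space d)} {T : ℝ}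

theorem memLp_spaceFourier [SFinite μ] (hμ : Integrable weight μ) (hφ : ContDiff ℝ 1 φ)
    (hc : HasCompactSupport φ) : MemLp (spaceFourier φ) 2 (spectralProd T μ) := by
  obtain ⟨C, hC⟩ := exists_norm_spaceFourier_sq_le hφ hc
  exact memLp_two_of_sq_le
    (stronglyMeasurable_spaceFourier hφ.continuous.stronglyMeasurable).aestronglyMeasurable
    ((integrable_weight_snd hμ).const_mul C) hC

end Slice

/-! ### Isometry between the covariance and the spectral inner product. -/

section Covariance

variable {d : ℕ} {κ : Kernel d} {μ : Measure (Space d)} {T : ℝ}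

theorem covariance_eq_integral_pairing {φ ψ : ℝ × Space d → ℝ} (hφ : Continuous φ)
    (hφc : HasCompactSupport φ) (hψ : Continuous ψ) (hψc : HasCompactSupport ψ) :
    κ.covariance T φ ψ = ∫ t in Ioo 0 T,
      κ.pairing (correlation (fun x => φ (t, x)) fun x => ψ (t, x)) := by
  cases κ with
  | ofFun f hf =>
    refine integral_congr_ae (.of_forall fun t => ?_)
    exact integral_kernel_eq_pairing hf (hφ.comp (by fun_prop)) (hasCompactSupport_slice hφc t)
      (hψ.comp (by fun_prop)) (hasCompactSupport_slice hψc t)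
  | whiteNoise => simp [Kernel.covariance, Kernel.pairing, correlation]

/-- The correlation of two test functions is again a test function, so it may be inserted in the
definition of the spectral measure. -/
theorem pairing_correlation (hκ : IsSpectralMeasure κ μ) {φ ψ : Space d → ℝ}
    (hφ : ContDiff ℝ ((⊤ : ℕ∞) : WithTop ℕ∞) φ) (hφc : HasCompactSupport φ)
    (hψ : ContDiff ℝ ((⊤ : ℕ∞) : WithTop ℕ∞) ψ) (hψc : HasCompactSupport ψ) :
    ((κ.pairing (correlation φ ψ) : ℝ) : ℂ) =
      ∫ ξ, fourier φ ξ * (starRingEnd ℂ) (fourier ψ ξ) ∂μ := by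
  have h := hκ ⟨correlation φ ψ, contDiff_correlation hφ.continuous hψ hψc,
    hasCompactSupport_correlation hφc hψc, subset_univ _⟩
  simp only [TestFunction.coe_mk] at h
  rw [h]
  refine integral_congr_ae (.of_forall fun ξ => ?_)
  exact fourier_correlation (hφ.continuous.integrable_of_hasCompactSupport hφc)
    (hψ.continuous.integrable_of_hasCompactSupport hψc) ξ

/-- The isometry between the noise and its spectral representation. -/
theorem covariance_eq_inner [SFinite μ] (hκ : IsSpectralMeasure κ μ) (φ ψ : 𝓓(region T d, ℝ))
    (hφ : MemLp (spaceFourier φ) 2 (spectralProd T μ))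
    (hψ : MemLp (spaceFourier ψ) 2 (spectralProd T μ)) :
    κ.covariance T φ ψ = inner ℝ (hφ.toLp _) (hψ.toLp _) := by
  have hprod : Integrable
      (fun p => spaceFourier φ p * (starRingEnd ℂ) (spaceFourier ψ p)) (spectralProd T μ) :=
    hφ.integrable_mul hψ.star
  have hre : ∀ p, inner ℝ (spaceFourier φ p) (spaceFourier ψ p) =
      (spaceFourier φ p * (starRingEnd ℂ) (spaceFourier ψ p)).re := fun p => by
    rw [Complex.inner]; simp; ring
  rw [inner_toLp_toLp, covariance_eq_integral_pairing φ.continuous φ.hasCompactSupport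
    ψ.continuous ψ.hasCompactSupport]
  simp only [hre]
  rw [← Complex.ofReal_inj]
  have h1 : ((∫ p, (spaceFourier φ p * (starRingEnd ℂ) (spaceFourier ψ p)).re
      ∂spectralProd T μ : ℝ)) = (∫ p, (spaceFourier φ p * (starRingEnd ℂ) (spaceFourier ψ p))
      ∂spectralProd T μ).re := integral_re hprod
  -- The Hermitian integral is already real, so passing to the real inner product loses nothing.
  have h2 : ∫ p, (spaceFourier φ p * (starRingEnd ℂ) (spaceFourier ψ p)) ∂spectralProd T μ =
      ((∫ t in Ioo 0 T, κ.pairing (correlation (fun x => φ (t, x)) fun x => ψ (t, x)) : ℝ) : ℂ) := by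
    rw [spectralProd, integral_prod _ hprod, ← integral_complex_ofReal]
    refine integral_congr_ae (.of_forall fun t => ?_)
    exact (pairing_correlation hκ (contDiff_slice φ.contDiff t)
      (hasCompactSupport_slice φ.hasCompactSupport t) (contDiff_slice ψ.contDiff t)
      (hasCompactSupport_slice ψ.hasCompactSupport t)).symm
  rw [h1, h2, Complex.ofReal_re]

/-- Identifies the filter in `stochIntegral` with convergence in the spectral `L²` space. -/
theorem distSq_eq_edist_sq [SFinite μ] {f g : ℝ × Space d → ℂ}
    (hf : MemLp f 2 (spectralProd T μ)) (hg : MemLp g 2 (spectralProd T μ)) :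
    distSq T μ (fun t ξ => f (t, ξ)) (fun t ξ => g (t, ξ)) =
      edist (hf.toLp f) (hg.toLp g) ^ 2 := by
  rw [Lp.edist_toLp_toLp, eLpNorm_eq_lintegral_rpow_enorm_toReal two_ne_zero ENNReal.ofNat_ne_top,
    ← ENNReal.rpow_natCast, ← ENNReal.rpow_mul]
  simp only [ENNReal.toReal_ofNat, Nat.cast_ofNat, one_div, isUnit_iff_ne_zero,
    ne_eq, OfNat.ofNat_ne_zero, not_false_eq_true, IsUnit.inv_mul_cancel, ENNReal.rpow_one,
    ENNReal.rpow_ofNat]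
  rw [spectralProd, lintegral_prod _ ((hf.1.sub hg.1).enorm.pow_const 2)]
  rfl

end Covariance

/-! ### The heat kernel: Fourier transform, mass and gradient. -/

section HeatKernel

variable {d : ℕ}

theorem heatKernel_of_pos {t : ℝ} (ht : 0 < t) (x : Space d) :
    heatKernel t x = (4 * Real.pi * t) ^ (-(d : ℝ) / 2) * Real.exp (-‖x‖ ^ 2 / (4 * t)) :=
  if_pos ht

theorem heatKernel_of_nonpos {t : ℝ} (ht : t ≤ 0) (x : Space d) : heatKernel t x = 0 :=
  if_neg ht.not_gt

theorem heatKernel_nonneg (t : ℝ) (x : Space d) : 0 ≤ heatKernel t x := by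
  rw [heatKernel]
  split_ifs with ht
  · positivity
  · rfl

theorem fourier_heatKernel_sub {t : ℝ} (ht : 0 < t) (x ξ : Space d) :
    fourier (fun y => heatKernel t (x - y)) ξ =
      char ξ x * (Real.exp (-t * ‖ξ‖ ^ 2) : ℝ) := by
  have hb : 0 < (((1 / (4 * t) : ℝ) : ℂ)).re := by
    rw [Complex.ofReal_re]; positivity
  -- The linear coefficient is `+i`: the substitution `y ↦ x - y` below reverses the sign in the
  -- character.
  have key := GaussianFourier.integral_cexp_neg_mul_sq_norm_add hb Complex.I ξ
  rw [fourier_eq, ← integral_sub_left_eq_self (fun y => char ξ y * (heatKernel t (x - y) : ℂ))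
    volume x]
  have h1 : ∀ y : Space d, char ξ (x - y) * (heatKernel t (x - (x - y)) : ℂ) =
      char ξ x * (((4 * Real.pi * t) ^ (-(d : ℝ) / 2) : ℝ) : ℂ) *
        Complex.exp (-((1 / (4 * t) : ℝ) : ℂ) * (‖y‖ : ℂ) ^ 2 +
          Complex.I * ((inner ℝ ξ y : ℝ) : ℂ)) := by
    intro y
    rw [sub_sub_cancel, heatKernel_of_pos ht, sub_eq_add_neg, char_add, Complex.exp_add, char,
      char, inner_neg_right]
    push_cast
    ring_nf
  simp only [h1, integral_const_mul, key]
  rw [mul_assoc]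
  congr 1
  have h2 : ((Real.pi : ℂ) / ((1 / (4 * t) : ℝ) : ℂ)) = ((4 * Real.pi * t : ℝ) : ℂ) := by
    push_cast; field_simp
  have h3 : ((Module.finrank ℝ (Space d) / 2 : ℂ)) = (((d : ℝ) / 2 : ℝ) : ℂ) := by simp
  have hpos : 0 < 4 * Real.pi * t := by positivity
  rw [h2, h3, ← Complex.ofReal_cpow hpos.le, ← mul_assoc, ← Complex.ofReal_mul,
    ← Real.rpow_add hpos, neg_div, neg_add_cancel, Real.rpow_zero, Complex.ofReal_one, one_mul,
    Complex.ofReal_exp]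
  congr 1
  push_cast
  have : (t : ℂ) ≠ 0 := by exact_mod_cast ht.ne'
  rw [Complex.I_sq]
  field_simp

theorem integral_heatKernel_sub {t : ℝ} (ht : 0 < t) (x : Space d) :
    ∫ y, heatKernel t (x - y) = 1 := by
  have h := fourier_heatKernel_sub ht x 0
  simp only [fourier_eq, char, inner_zero_left, Complex.ofReal_zero, mul_zero, neg_zero,
    Complex.exp_zero, one_mul, norm_zero, ne_eq, OfNat.ofNat_ne_zero, not_false_eq_true, zero_pow,
    Real.exp_zero, Complex.ofReal_one, integral_complex_ofReal] at h
  exact_mod_cast h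

/-- A non-integrable function has integral `0` by convention, but this integral is `1`. -/
theorem integrable_heatKernel_sub {t : ℝ} (ht : 0 < t) (x : Space d) :
    Integrable fun y => heatKernel t (x - y) := by
  by_contra h
  exact zero_ne_one ((integral_undef h).symm.trans (integral_heatKernel_sub ht x))

theorem contDiffAt_heatKernel_sub {t : ℝ} (x : Space d) {p : ℝ × Space d} (hp : p.1 < t)
    {n : WithTop ℕ∞} : ContDiffAt ℝ n (fun p => heatKernel (t - p.1) (x - p.2)) p := by
  have h1 : ContDiffAt ℝ n (fun p : ℝ × Space d => t - p.1) p := contDiffAt_const.sub contDiffAt_fst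
  have h2 : ContDiffAt ℝ n (fun p : ℝ × Space d => ‖x - p.2‖ ^ 2) p :=
    (contDiffAt_const.sub contDiffAt_snd).norm_sq ℝ
  have h0 : 0 < t - p.1 := sub_pos.2 hp
  have h3 : ContDiffAt ℝ n (fun p : ℝ × Space d =>
      (4 * Real.pi * (t - p.1)) ^ (-(d : ℝ) / 2) *
        Real.exp (-‖x - p.2‖ ^ 2 / (4 * (t - p.1)))) p := by
    refine ContDiffAt.mul ((contDiffAt_const.mul h1).rpow_const_of_ne (by positivity)) ?_
    exact (h2.neg.div (contDiffAt_const.mul h1) (by positivity)).exp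
  refine h3.congr_of_eventuallyEq ?_
  filter_upwards [(isOpen_Iio.preimage continuous_fst).mem_nhds hp] with q hq
  exact heatKernel_of_pos (sub_pos.2 hq) _

/-- With `r = |x - y|`, the gradient has the extra factor `r/(2t)`. Half of the Gaussian exponent
absorbs `r/(2√t)`, leaving the Gaussian of time `2t`; the factor `2^(d/2)` corrects the
normalization. -/
theorem norm_fderiv_heatKernel_sub_le {t : ℝ} (ht : 0 < t) (x y : Space d) :
    ‖fderiv ℝ (fun y => heatKernel t (x - y)) y‖ ≤
      t ^ (-(1 / 2) : ℝ) * 2 ^ ((d : ℝ) / 2) * heatKernel (2 * t) (x - y) := by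
  set c : ℝ := (4 * Real.pi * t) ^ (-(d : ℝ) / 2) with hc
  have hc0 : 0 ≤ c := by positivity
  have h1 : HasFDerivAt (fun y : Space d => ‖x - y‖ ^ 2)
      (-(2 • (innerSL ℝ (x - y)))) y := by
    have := ((hasFDerivAt_id y).const_sub x).norm_sq
    convert! this using 1
    ext v; simp; ring
  have h2 : HasFDerivAt (fun y => heatKernel t (x - y))
      (c • (Real.exp (-‖x - y‖ ^ 2 / (4 * t)) • ((4 * t)⁻¹ • (2 • (innerSL ℝ (x - y)))))) y := by
    simp only [heatKernel_of_pos ht]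
    refine HasFDerivAt.const_mul (HasFDerivAt.exp ?_) c
    simp only [div_eq_mul_inv]
    have := h1.neg.mul_const (4 * t)⁻¹
    rwa [neg_neg] at this
  rw [h2.fderiv, norm_smul, norm_smul, norm_smul, ← Nat.cast_smul_eq_nsmul ℝ, norm_smul,
    innerSL_apply_norm, Real.norm_of_nonneg hc0, Real.norm_of_nonneg (Real.exp_pos _).le,
    Real.norm_of_nonneg (by positivity : (0 : ℝ) ≤ (4 * t)⁻¹), heatKernel_of_pos (by positivity)]
  set r := ‖x - y‖
  have hsq : 0 < Real.sqrt t := Real.sqrt_pos.2 ht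
  have ht2 : Real.sqrt t ^ 2 = t := Real.sq_sqrt ht.le
  have h3 : (4 * Real.pi * (2 * t)) ^ (-(d : ℝ) / 2) * 2 ^ ((d : ℝ) / 2) = c := by
    rw [hc, show 4 * Real.pi * (2 * t) = (4 * Real.pi * t) * 2 by ring,
      Real.mul_rpow (by positivity) (by positivity), mul_assoc, ← Real.rpow_add two_pos, neg_div,
      neg_add_cancel, Real.rpow_zero, mul_one]
  have h4 : t ^ (-(1 / 2) : ℝ) = (Real.sqrt t)⁻¹ := by
    rw [Real.rpow_neg ht.le, Real.sqrt_eq_rpow]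
  -- For `a = r/(2√t)` and `b = r²/(8t)` one has `a² = 2b`, so `a ≤ (1 + a²)/2 ≤ 1 + b ≤ exp b`.
  have h5 : r / (2 * Real.sqrt t) ≤ Real.exp (r ^ 2 / (8 * t)) := by
    have h6 : (r / (2 * Real.sqrt t)) ^ 2 = 2 * (r ^ 2 / (8 * t)) := by
      rw [div_pow, mul_pow, ht2]; field_simp; norm_num
    have h7 := Real.add_one_le_exp (r ^ 2 / (8 * t))
    nlinarith [sq_nonneg (r / (2 * Real.sqrt t) - 1)]
  have h8 : Real.exp (-r ^ 2 / (4 * t)) * Real.exp (r ^ 2 / (8 * t)) =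
      Real.exp (-r ^ 2 / (4 * (2 * t))) := by
    rw [← Real.exp_add]; congr 1; field_simp; ring
  calc c * (Real.exp (-r ^ 2 / (4 * t)) * ((4 * t)⁻¹ * (‖((2 : ℕ) : ℝ)‖ * r)))
      = c * (Real.sqrt t)⁻¹ * (Real.exp (-r ^ 2 / (4 * t)) * (r / (2 * Real.sqrt t))) := by
        have : (4 * t)⁻¹ * (‖((2 : ℕ) : ℝ)‖ * r) = (Real.sqrt t)⁻¹ * (r / (2 * Real.sqrt t)) := by
          simp only [Nat.cast_ofNat, Real.norm_ofNat]
          nth_rewrite 1 [← ht2]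
          field_simp; norm_num
        rw [this]; ring
    _ ≤ c * (Real.sqrt t)⁻¹ * (Real.exp (-r ^ 2 / (4 * t)) * Real.exp (r ^ 2 / (8 * t))) := by
        gcongr
    _ = _ := by rw [h8, h4, ← h3]; ring

end HeatKernel

/-! ### Square integrability of the transformed heat kernel. -/

section HeatFourier

variable {d : ℕ} {μ : Measure (Space d)} {T : ℝ}

/-- The Fourier transform in space of `(s,y) ↦ G(t-s,x-y)`. -/
def heatFourier (t : ℝ) (x : Space d) (p : ℝ × Space d) : ℂ :=
  if p.1 < t then char p.2 x * (Real.exp (-(t - p.1) * ‖p.2‖ ^ 2) : ℝ) else 0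

theorem spaceFourier_heatKernel (t : ℝ) (x : Space d) :
    spaceFourier (fun p => heatKernel (t - p.1) (x - p.2)) = heatFourier t x := by
  ext p
  rw [heatFourier, spaceFourier]
  split_ifs with h
  · exact fourier_heatKernel_sub (sub_pos.2 h) x p.2
  · simp [heatKernel_of_nonpos (sub_nonpos.2 (not_lt.1 h)), fourier]

theorem stronglyMeasurable_heatFourier_uncurry :
    StronglyMeasurable fun q : (ℝ × Space d) × (ℝ × Space d) => heatFourier q.1.1 q.1.2 q.2 := by
  refine StronglyMeasurable.ite (measurableSet_lt (by fun_prop) (by fun_prop)) ?_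
    stronglyMeasurable_const
  have h1 : Continuous fun q : (ℝ × Space d) × (ℝ × Space d) => char q.2.2 q.1.2 := by
    unfold char; fun_prop
  have h2 : Continuous fun q : (ℝ × Space d) × (ℝ × Space d) =>
      ((Real.exp (-(q.1.1 - q.2.1) * ‖q.2.2‖ ^ 2) : ℝ) : ℂ) := by fun_prop
  exact (h1.mul h2).stronglyMeasurable

theorem stronglyMeasurable_heatFourier (t : ℝ) (x : Space d) :
    StronglyMeasurable (heatFourier t x) :=
  stronglyMeasurable_heatFourier_uncurry.comp_measurable
    (g := fun p : ℝ × Space d => ((t, x), p)) (measurable_const.prodMk measurable_id)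

theorem norm_heatFourier (t : ℝ) (x : Space d) (p : ℝ × Space d) :
    ‖heatFourier t x p‖ = if p.1 < t then Real.exp (-(t - p.1) * ‖p.2‖ ^ 2) else 0 := by
  rw [heatFourier]
  split_ifs
  · rw [norm_mul, norm_char, one_mul, Complex.norm_real, Real.norm_of_nonneg (Real.exp_pos _).le]
  · simp

/-- The dissipation of the heat semigroup gains the weight. -/
theorem integral_norm_heatFourier_sq_le {t : ℝ} (ht : t ∈ Icc 0 T) (x ξ : Space d) :
    ∫ s in Ioo 0 T, ‖heatFourier t x (s, ξ)‖ ^ 2 ≤ (T + 1) * weight ξ := by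
  have h1 : ∀ s, ‖heatFourier t x (s, ξ)‖ ^ 2 =
      (Iio t).indicator (fun s => Real.exp (-2 * (t - s) * ‖ξ‖ ^ 2)) s := fun s => by
    rw [norm_heatFourier, indicator_apply]
    simp only [mem_Iio]
    split_ifs
    · rw [← Real.exp_nat_mul]; congr 1; push_cast; ring
    · simp
  have h2 : Ioo 0 T ∩ Iio t = Ioo 0 t := by
    rw [← Ioi_inter_Iio, inter_assoc, Iio_inter_Iio, min_eq_right ht.2, Ioi_inter_Iio]
  simp only [h1]
  rw [setIntegral_indicator measurableSet_Iio, h2, ← integral_Ioc_eq_integral_Ioo,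
    ← intervalIntegral.integral_of_le ht.1, weight, mul_one_div, le_div_iff₀ (by positivity),
    mul_add, mul_one]
  have hcont : Continuous fun s : ℝ => Real.exp (-2 * (t - s) * ‖ξ‖ ^ 2) := by fun_prop
  -- The two summands of `1 + |ξ|²` are treated separately: the integrand is at most `1`, and after
  -- multiplication by `|ξ|²` it has an explicit primitive. Together they give `T + 1`.
  have h3 : ∫ s in (0 : ℝ)..t, Real.exp (-2 * (t - s) * ‖ξ‖ ^ 2) ≤ t := by
    have := intervalIntegral.integral_mono_on ht.1 (hcont.intervalIntegrable (μ := volume) 0 t)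
      (intervalIntegrable_const (c := (1 : ℝ))) fun s hs => by
        refine Real.exp_le_one_iff.2 ?_
        have : 0 ≤ (t - s) * ‖ξ‖ ^ 2 := mul_nonneg (sub_nonneg.2 hs.2) (sq_nonneg _)
        linarith
    simpa using this
  have h4 : (∫ s in (0 : ℝ)..t, Real.exp (-2 * (t - s) * ‖ξ‖ ^ 2)) * ‖ξ‖ ^ 2 ≤ 1 := by
    rw [← intervalIntegral.integral_mul_const, intervalIntegral.integral_eq_sub_of_hasDerivAt
      (f := fun s => Real.exp (-2 * (t - s) * ‖ξ‖ ^ 2) / 2) (fun s _ => ?_)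
      (hcont.mul_const (‖ξ‖ ^ 2) |>.intervalIntegrable 0 t)]
    · have := Real.exp_pos (-2 * (t - 0) * ‖ξ‖ ^ 2)
      simp only [sub_self, mul_zero, zero_mul, Real.exp_zero]
      linarith
    · have h5 : HasDerivAt (fun s : ℝ => -2 * (t - s) * ‖ξ‖ ^ 2) (2 * ‖ξ‖ ^ 2) s := by
        have := (((hasDerivAt_id s).const_sub t).const_mul (-2)).mul_const (‖ξ‖ ^ 2)
        convert! this using 1; ring
      convert! h5.exp.div_const 2 using 1; ring
  linarith [ht.2]

theorem integrable_norm_heatFourier_sq [SFinite μ] (hμ : Integrable weight μ) {t : ℝ}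
    (ht : t ∈ Icc 0 T) (x : Space d) :
    Integrable (fun p => ‖heatFourier t x p‖ ^ 2) (spectralProd T μ) := by
  have hm : StronglyMeasurable fun p => ‖heatFourier t x p‖ ^ 2 :=
    (stronglyMeasurable_heatFourier t x).norm.pow 2
  rw [spectralProd, integrable_prod_iff' hm.aestronglyMeasurable]
  constructor
  · refine .of_forall fun ξ => Integrable.mono' (integrable_const (1 : ℝ))
      (hm.comp_measurable (measurable_id.prodMk measurable_const)).aestronglyMeasurable
      (.of_forall fun s => ?_)
    rw [Real.norm_of_nonneg (by positivity)]
    refine pow_le_one₀ (norm_nonneg _) ?_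
    rw [norm_heatFourier]
    split_ifs with hs
    · refine Real.exp_le_one_iff.2 ?_
      have : 0 ≤ (t - s) * ‖ξ‖ ^ 2 := mul_nonneg (sub_nonneg.2 hs.le) (sq_nonneg _)
      simp only at *
      linarith
    · exact zero_le_one
  · refine (hμ.const_mul (T + 1)).mono' hm.norm.integral_prod_left'.aestronglyMeasurable
      (.of_forall fun ξ => ?_)
    rw [Real.norm_of_nonneg (integral_nonneg fun s => norm_nonneg _)]
    simpa using integral_norm_heatFourier_sq_le ht x ξ

/-- The bound is independent of `(t,x)`, as needed for Fubini in `spectralRep_mem_closure_span`. -/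
theorem integral_norm_heatFourier_sq_le_const [SFinite μ] (hμ : Integrable weight μ) {t : ℝ}
    (ht : t ∈ Icc 0 T) (x : Space d) :
    ∫ p, ‖heatFourier t x p‖ ^ 2 ∂spectralProd T μ ≤ (T + 1) * ∫ ξ, weight ξ ∂μ := by
  have h := integrable_norm_heatFourier_sq hμ ht x
  rw [spectralProd] at h ⊢
  rw [integral_prod_symm _ h, ← integral_const_mul]
  exact integral_mono h.integral_prod_right (hμ.const_mul _)
    fun ξ => integral_norm_heatFourier_sq_le ht x ξ

theorem memLp_heatFourier [SFinite μ] (hμ : Integrable weight μ) {t : ℝ}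
    (ht : t ∈ Icc 0 T) (x : Space d) : MemLp (heatFourier t x) 2 (spectralProd T μ) :=
  (memLp_two_iff_integrable_sq_norm (stronglyMeasurable_heatFourier t x).aestronglyMeasurable).2
    (integrable_norm_heatFourier_sq hμ ht x)

end HeatFourier

/-! ### Approximation of the heat kernel by test functions. -/

section Density

variable {d : ℕ} {μ : Measure (Space d)} {T : ℝ}

/-- The spectral representation of the noise `F(φ)`. -/
def spectralRep [SFinite μ] (hμ : Integrable weight μ) (φ : 𝓓(region T d, ℝ)) :
    Lp ℂ 2 (spectralProd T μ) :=
  (memLp_spaceFourier hμ (φ.contDiff.of_le (by exact_mod_cast le_top))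
    φ.hasCompactSupport).toLp (spaceFourier φ)

/-- The heat kernel is smooth for `s < t`, and the time cutoff is supported strictly inside that
range. -/
theorem exists_truncated_heatKernel {t : ℝ} (ht : t ≤ T) (x : Space d) {α : ℝ → ℝ}
    (hα : ContDiff ℝ ((⊤ : ℕ∞) : WithTop ℕ∞) α) (hαc : HasCompactSupport α)
    (hαs : tsupport α ⊆ Ioo 0 t) {χ : Space d → ℝ} (hχ : ContDiff ℝ ((⊤ : ℕ∞) : WithTop ℕ∞) χ)
    (hχc : HasCompactSupport χ) :
    ∃ ψ : 𝓓(region T d, ℝ), ∀ s y, ψ (s, y) = α s * χ y * heatKernel (t - s) (x - y) := by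
  set ψ : ℝ × Space d → ℝ := fun p => α p.1 * χ p.2 * heatKernel (t - p.1) (x - p.2) with hψ
  have hK : IsCompact (tsupport α ×ˢ tsupport χ) := hαc.isCompact.prod hχc.isCompact
  have hsub : Function.support ψ ⊆ tsupport α ×ˢ tsupport χ := fun p hp => by
    have h1 : α p.1 * χ p.2 ≠ 0 := left_ne_zero_of_mul hp
    exact ⟨subset_tsupport α (left_ne_zero_of_mul h1), subset_tsupport χ (right_ne_zero_of_mul h1)⟩
  have hsub' : tsupport ψ ⊆ tsupport α ×ˢ tsupport χ := closure_minimal hsub hK.isClosed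
  refine ⟨⟨ψ, contDiff_iff_contDiffAt.2 fun p => ?_,
    HasCompactSupport.of_support_subset_isCompact hK hsub, fun p hp => ?_⟩, fun s y => rfl⟩
  · by_cases hp : p ∈ tsupport ψ
    swap
    · exact (contDiffAt_const (c := (0 : ℝ))).congr_of_eventuallyEq
        (notMem_tsupport_iff_eventuallyEq.1 hp)
    exact ((hα.comp contDiff_fst).contDiffAt.mul (hχ.comp contDiff_snd).contDiffAt).mul
      (contDiffAt_heatKernel_sub x (hαs (hsub' hp).1).2)
  · exact ⟨⟨(hαs (hsub' hp).1).1, (hαs (hsub' hp).1).2.trans_le ht⟩, mem_univ _⟩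

theorem integral_norm_truncated_le {α τ : ℝ} (hα : |α| ≤ 1) (hτ : 0 < τ) (x : Space d)
    {χ : Space d → ℝ} (hχ : ∀ y, |χ y| ≤ 1) :
    ∫ y, ‖α * χ y * heatKernel τ (x - y)‖ ≤ 1 := by
  rw [← integral_heatKernel_sub hτ x]
  refine integral_mono_of_nonneg (.of_forall fun y => norm_nonneg _)
    (integrable_heatKernel_sub hτ x) (.of_forall fun y => ?_)
  simp only [norm_mul, Real.norm_eq_abs, abs_of_nonneg (heatKernel_nonneg _ _)]
  exact mul_le_of_le_one_left (heatKernel_nonneg _ _)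
    (mul_le_one₀ hα (abs_nonneg _) (hχ y))

/-- Product rule: a derivative on the cutoff costs `C`, one on the kernel costs `τ^(-1/2) 2^(d/2)`,
and the kernels of times `τ` and `2τ` both have mass `1`. -/
theorem integral_norm_fderiv_truncated_le {α τ δ C : ℝ} (hα : |α| ≤ 1) (hδ : 0 < δ) (hτ : δ ≤ τ)
    (x : Space d) {χ : Space d → ℝ} (hχd : Differentiable ℝ χ) (hχ : ∀ y, |χ y| ≤ 1)
    (hχ' : ∀ y, ‖fderiv ℝ χ y‖ ≤ C) :
    ∫ y, ‖fderiv ℝ (fun y => α * χ y * heatKernel τ (x - y)) y‖ ≤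
      C + δ ^ (-(1 / 2) : ℝ) * 2 ^ ((d : ℝ) / 2) := by
  have hτ0 : 0 < τ := hδ.trans_le hτ
  set c : ℝ := δ ^ (-(1 / 2) : ℝ) * 2 ^ ((d : ℝ) / 2) with hc
  have hbound : ∫ y, (C * heatKernel τ (x - y) + c * heatKernel (2 * τ) (x - y)) = C + c := by
    rw [integral_add ((integrable_heatKernel_sub hτ0 x).const_mul _)
      ((integrable_heatKernel_sub (by positivity) x).const_mul _), integral_const_mul,
      integral_const_mul, integral_heatKernel_sub hτ0, integral_heatKernel_sub (by positivity),
      mul_one, mul_one]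
  rw [← hbound]
  refine integral_mono_of_nonneg (.of_forall fun y => norm_nonneg _)
    (((integrable_heatKernel_sub hτ0 x).const_mul _).add
      ((integrable_heatKernel_sub (by positivity) x).const_mul _)) (.of_forall fun y => ?_)
  have hG : DifferentiableAt ℝ (fun y => heatKernel τ (x - y)) y := by
    have h1 : ContDiffAt ℝ 1 (fun p : ℝ × Space d => heatKernel (τ - p.1) (x - p.2)) (0, y) :=
      contDiffAt_heatKernel_sub x hτ0
    have h2 := (h1.differentiableAt one_ne_zero).comp y
      ((hasFDerivAt_prodMk_right (𝕜 := ℝ) (0 : ℝ) y).differentiableAt)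
    simpa [Function.comp_def] using h2
  have h3 := (((hχd y).hasFDerivAt.const_mul α).mul hG.hasFDerivAt).fderiv
  simp only [] at h3 ⊢
  have h4 := norm_fderiv_heatKernel_sub_le hτ0 x y
  have h5 : τ ^ (-(1 / 2) : ℝ) ≤ δ ^ (-(1 / 2) : ℝ) :=
    Real.rpow_le_rpow_of_nonpos hδ hτ (by norm_num)
  have hG2 := heatKernel_nonneg (2 * τ) (x - y)
  refine (congrArg norm h3).trans_le ((norm_add_le _ _).trans ?_)
  rw [norm_smul, norm_smul, norm_smul, Real.norm_eq_abs, Real.norm_eq_abs, Real.norm_eq_abs,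
    abs_of_nonneg (heatKernel_nonneg _ _), add_comm]
  refine add_le_add ?_ ?_
  · rw [mul_comm]
    refine mul_le_mul_of_nonneg_right ?_ (heatKernel_nonneg _ _)
    exact (mul_le_of_le_one_left (norm_nonneg _) hα).trans (hχ' y)
  · have h6 : |α * χ y| ≤ 1 := by
      rw [abs_mul]; exact mul_le_one₀ hα (abs_nonneg _) (hχ y)
    refine (mul_le_of_le_one_left (norm_nonneg _) h6).trans (h4.trans ?_)
    rw [hc]
    gcongr

/-- Time-truncated heat kernels are limits of test functions. -/
theorem mul_heatFourier_mem_closure [SFinite μ] (hμ : Integrable weight μ) {t : ℝ} (ht : t ≤ T)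
    (x : Space d) {α : ℝ → ℝ} (hα : ContDiff ℝ ((⊤ : ℕ∞) : WithTop ℕ∞) α)
    (hαc : HasCompactSupport α) (hαs : tsupport α ⊆ Ioo 0 t) (hα1 : ∀ s, |α s| ≤ 1)
    (hL : MemLp (fun p => (α p.1 : ℂ) * heatFourier t x p) 2 (spectralProd T μ)) :
    hL.toLp _ ∈ closure (range (spectralRep (T := T) hμ)) := by
  let χ : ContDiffBump (0 : Space d) := ⟨1, 2, one_pos, one_lt_two⟩
  have hχ1 : ∀ y, |χ y| ≤ 1 := fun y => by
    rw [abs_of_nonneg χ.nonneg]; exact χ.le_one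
  have hχd : ContDiff ℝ ((⊤ : ℕ∞) : WithTop ℕ∞) χ := χ.contDiff
  obtain ⟨C, hC⟩ := (hχd.continuous_fderiv (by simp)).bounded_above_of_compact_support
    (χ.hasCompactSupport.fderiv ℝ)
  have hC0 : 0 ≤ C := (norm_nonneg _).trans (hC 0)
  -- Dilation by `c n ≤ 1` widens the cutoff without increasing its gradient.
  let c : ℕ → ℝ := fun n => 1 / ((n : ℝ) + 1)
  have hc0 : ∀ n, 0 < c n := fun n => Nat.one_div_pos_of_nat
  have hc1 : ∀ n, c n ≤ 1 := fun n => by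
    simp only [c]; rw [div_le_one (by positivity)]; linarith [n.cast_nonneg (α := ℝ)]
  have hclim : Tendsto c atTop (𝓝 0) := tendsto_one_div_add_atTop_nhds_zero_nat
  let χn : ℕ → Space d → ℝ := fun n y => χ (c n • y)
  have hχnd : ∀ n, ContDiff ℝ ((⊤ : ℕ∞) : WithTop ℕ∞) (χn n) := fun n =>
    hχd.comp (contDiff_const_smul _)
  have hχnc : ∀ n, HasCompactSupport (χn n) := fun n =>
    χ.hasCompactSupport.comp_smul (hc0 n).ne'
  have hχn' : ∀ n y, ‖fderiv ℝ (χn n) y‖ ≤ C := fun n y => by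
    rw [show χn n = fun y => χ (c n • y) from rfl, fderiv_comp_smul, norm_smul,
      Real.norm_of_nonneg (hc0 n).le]
    exact (mul_le_of_le_one_left (norm_nonneg _) (hc1 n)).trans (hC _)
  choose ψ hψ using fun n => exists_truncated_heatKernel ht x hα hαc hαs (hχnd n) (hχnc n)
  -- By compactness the support of `α` keeps a positive distance from the singular time `t`; the
  -- gradient bound `B` is then uniform in time and in `n`.
  obtain ⟨δ, hδ0, hδ⟩ : ∃ δ > 0, ∀ s ∈ tsupport α, δ ≤ t - s := by
    rcases (tsupport α).eq_empty_or_nonempty with h | h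
    · exact ⟨1, one_pos, by simp [h]⟩
    · obtain ⟨s, hs, hmax⟩ := hαc.isCompact.exists_isMaxOn h continuousOn_id
      exact ⟨t - s, sub_pos.2 (hαs hs).2, fun r hr => sub_le_sub_left (hmax hr) _⟩
  set B : ℝ := C + δ ^ (-(1 / 2) : ℝ) * 2 ^ ((d : ℝ) / 2) with hB
  have hfun : ∀ n s, (fun y => ψ n (s, y)) = fun y => α s * χn n y * heatKernel (t - s) (x - y) :=
    fun n s => funext (hψ n s)
  have hbound : ∀ n p, ‖spaceFourier (ψ n) p‖ ^ 2 ≤ (1 ^ 2 + B ^ 2) * weight p.2 := fun n p => by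
    by_cases hp : p.1 ∈ tsupport α
    · have hτ := hδ _ hp
      refine norm_fourier_sq_le (contDiff_slice ((ψ n).contDiff.of_le
        (by exact_mod_cast le_top)) p.1)
        (hasCompactSupport_slice (ψ n).hasCompactSupport p.1) ?_ ?_ p.2
      · simp only [hψ]
        exact integral_norm_truncated_le (hα1 _) (hδ0.trans_le hτ) x fun y => hχ1 _
      · rw [hfun]
        exact integral_norm_fderiv_truncated_le (hα1 _) hδ0 hτ x
          ((hχnd n).differentiable (by simp)) (fun y => hχ1 _) (hχn' n)
    · have : spaceFourier (ψ n) p = 0 := by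
        rw [spaceFourier, hfun, image_eq_zero_of_notMem_tsupport hp]
        simp [fourier]
      rw [this]
      simpa using mul_nonneg (by positivity) (weight_pos p.2).le
  have hlim : ∀ p, Tendsto (fun n => spaceFourier (ψ n) p) atTop
      (𝓝 ((α p.1 : ℂ) * heatFourier t x p)) := fun p => by
    rw [← spaceFourier_heatKernel, spaceFourier, ← fourier_const_mul]
    have hint : Integrable fun y => heatKernel (t - p.1) (x - y) := by
      rcases lt_or_ge 0 (t - p.1) with h | h
      · exact integrable_heatKernel_sub h x
      · simp [heatKernel_of_nonpos h]
    refine tendsto_integral_of_dominated_convergence (fun y => heatKernel (t - p.1) (x - y))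
      (fun n => (integrable_char_mul (integrable_slice (ψ n).continuous (ψ n).hasCompactSupport _)
        _).aestronglyMeasurable) hint (fun n => .of_forall fun y => ?_) (.of_forall fun y => ?_)
    · refine (norm_char_mul (fun y => ψ n (p.1, y)) p.2 y).trans_le ?_
      rw [hψ, norm_mul, norm_mul, Real.norm_of_nonneg (heatKernel_nonneg _ _)]
      exact mul_le_of_le_one_left (heatKernel_nonneg _ _)
        (mul_le_one₀ (hα1 _) (norm_nonneg _) (hχ1 _))
    · refine tendsto_const_nhds.congr' ?_
      have h1 : Tendsto (fun n => c n • y) atTop (𝓝 0) := by simpa using hclim.smul_const y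
      filter_upwards [h1.eventually (Metric.closedBall_mem_nhds (0 : Space d) one_pos)] with n hn
      simp only [hψ, χn, χ.one_of_mem_closedBall hn, mul_one]
  exact mem_closure_of_tendsto (tendsto_toLp_of_dominated _ hL
    ((integrable_weight_snd hμ).const_mul _) hbound (.of_forall hlim))
    (.of_forall fun n => mem_range_self (ψ n))

/-- The representation of `u(t,x)` is a limit of test functions. -/
theorem heatFourier_mem_closure [SFinite μ] (hμ : Integrable weight μ) {t : ℝ} (ht : t ∈ Icc 0 T)
    (x : Space d) :
    (memLp_heatFourier hμ ht x).toLp _ ∈ closure (range (spectralRep (T := T) hμ)) := by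
  -- At `t = 0` the kernel vanishes for all `s` in `(0,T)`, so the zero test function represents it.
  rcases ht.1.eq_or_lt with rfl | ht0
  · refine subset_closure ⟨0, ?_⟩
    refine MemLp.toLp_congr _ _ ?_
    filter_upwards [ae_spectralProd_fst_mem] with p hp
    simp [heatFourier, hp.1.not_gt, spaceFourier, fourier]
  let c : ℕ → ℝ := fun n => 1 / ((n : ℝ) + 1)
  have hc0 : ∀ n, 0 < c n := fun n => Nat.one_div_pos_of_nat
  have hc1 : ∀ n, c n ≤ 1 := fun n => by
    simp only [c]; rw [div_le_one (by positivity)]; linarith [n.cast_nonneg (α := ℝ)]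
  have hclim : Tendsto c atTop (𝓝 0) := tendsto_one_div_add_atTop_nhds_zero_nat
  -- Bumps centred at the midpoint of `(0,t)`: the outer radius stays below `t/2`, and the inner one
  -- tends to `t/2`, so they exhaust the interval.
  let α : (n : ℕ) → ContDiffBump (t / 2) := fun n =>
    ⟨t / 2 * (1 - c n / 2), t / 2 * (1 - c n / 4),
      mul_pos (by linarith) (by linarith [hc1 n]), by
        have := hc0 n
        exact mul_lt_mul_of_pos_left (by linarith) (by linarith)⟩
  have hα1 : ∀ n s, |α n s| ≤ 1 := fun n s => by
    rw [abs_of_nonneg (α n).nonneg]; exact (α n).le_one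
  have hbound : ∀ n p, ‖(α n p.1 : ℂ) * heatFourier t x p‖ ^ 2 ≤ ‖heatFourier t x p‖ ^ 2 :=
    fun n p => by
      rw [norm_mul, Complex.norm_real]
      have := mul_le_of_le_one_left (norm_nonneg (heatFourier t x p)) (hα1 n p.1)
      gcongr
      exact this
  have hL : ∀ n, MemLp (fun p => (α n p.1 : ℂ) * heatFourier t x p) 2 (spectralProd T μ) :=
    fun n => memLp_two_of_sq_le ((Complex.continuous_ofReal.comp
      ((α n).continuous.comp continuous_fst)).aestronglyMeasurable.mul
      (stronglyMeasurable_heatFourier t x).aestronglyMeasurable)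
      (integrable_norm_heatFourier_sq hμ ht x) (hbound n)
  have hlim : ∀ᵐ p ∂spectralProd T μ, Tendsto (fun n => (α n p.1 : ℂ) * heatFourier t x p) atTop
      (𝓝 (heatFourier t x p)) := by
    filter_upwards [ae_spectralProd_fst_mem] with p hp
    refine tendsto_const_nhds.congr' ?_
    by_cases hpt : p.1 < t
    · have h1 : Tendsto (fun n => t / 2 * (1 - c n / 2)) atTop (𝓝 (t / 2)) := by
        simpa using ((hclim.div_const 2).const_sub 1).const_mul (t / 2)
      have h2 : |p.1 - t / 2| < t / 2 := abs_lt.2 ⟨by linarith [hp.1], by linarith⟩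
      filter_upwards [h1.eventually_const_lt h2] with n hn
      rw [(α n).one_of_mem_closedBall (by simpa [Real.dist_eq] using hn.le)]
      simp
    · simp [heatFourier, hpt]
  refine closure_minimal ?_ isClosed_closure (mem_closure_of_tendsto (tendsto_toLp_of_dominated hL
    (memLp_heatFourier hμ ht x) (integrable_norm_heatFourier_sq hμ ht x) hbound hlim)
    (.of_forall fun n => mem_range_self n))
  rintro _ ⟨n, rfl⟩
  refine mul_heatFourier_mem_closure hμ ht.2 x (α n).contDiff (α n).hasCompactSupport ?_ (hα1 n) _
  rw [(α n).tsupport_eq, Real.closedBall_eq_Icc]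
  have : 0 < t / 2 * (c n / 4) := mul_pos (by linarith) (by linarith [hc0 n])
  refine Icc_subset_Ioo ?_ ?_ <;> simp only [α] <;> linarith

end Density

/-! ### Duhamel's formula and the recovery of test functions. -/

section Duality

variable {d : ℕ} {μ : Measure (Space d)} {T : ℝ}

/-- The directional derivative of a function on time-space. -/
def dirDeriv (v : ℝ × Space d) (φ : ℝ × Space d → ℝ) (p : ℝ × Space d) : ℝ := fderiv ℝ φ p v

theorem contDiff_dirDeriv {φ : ℝ × Space d → ℝ} (hφ : ContDiff ℝ ((⊤ : ℕ∞) : WithTop ℕ∞) φ)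
    (v : ℝ × Space d) : ContDiff ℝ ((⊤ : ℕ∞) : WithTop ℕ∞) (dirDeriv v φ) :=
  (hφ.fderiv_right (by simp)).clm_apply contDiff_const

theorem hasCompactSupport_dirDeriv {φ : ℝ × Space d → ℝ} (hφ : HasCompactSupport φ)
    (v : ℝ × Space d) : HasCompactSupport (dirDeriv v φ) :=
  hφ.fderiv_apply ℝ v

theorem spaceFourier_dirDeriv_space {φ : ℝ × Space d → ℝ}
    (hφ : ContDiff ℝ ((⊤ : ℕ∞) : WithTop ℕ∞) φ) (hc : HasCompactSupport φ) (v : Space d)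
    (p : ℝ × Space d) :
    spaceFourier (dirDeriv (0, v) φ) p = Complex.I * (inner ℝ p.2 v : ℝ) * spaceFourier φ p := by
  rw [spaceFourier, spaceFourier, ← fourier_fderiv ((contDiff_slice hφ p.1).of_le (by simp))
    (hasCompactSupport_slice hc p.1)]
  congr 1
  ext x
  rw [(hasFDerivAt_slice (hφ.differentiable (by simp)) p.1 x).fderiv]
  rfl

theorem hasDerivAt_spaceFourier {φ : ℝ × Space d → ℝ}
    (hφ : ContDiff ℝ ((⊤ : ℕ∞) : WithTop ℕ∞) φ) (hc : HasCompactSupport φ) (t : ℝ)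
    (ξ : Space d) :
    HasDerivAt (fun t => spaceFourier φ (t, ξ)) (spaceFourier (dirDeriv (1, 0) φ) (t, ξ)) t := by
  have hφ' := contDiff_dirDeriv hφ (1, 0)
  have hc' := hasCompactSupport_dirDeriv hc (1, 0)
  obtain ⟨C, hC⟩ := hφ'.continuous.bounded_above_of_compact_support hc'
  set K := Prod.snd '' tsupport (dirDeriv (1, 0) φ)
  have hKc : IsCompact K := hc'.isCompact.image continuous_snd
  have hint : Integrable (K.indicator fun _ => C) :=
    (integrable_indicator_iff hKc.measurableSet).2 (integrableOn_const hKc.measure_lt_top.ne)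
  refine (hasDerivAt_integral_of_dominated_loc_of_deriv_le (s := univ)
    (F := fun t x => char ξ x * (φ (t, x) : ℂ))
    (F' := fun t x => char ξ x * (dirDeriv (1, 0) φ (t, x) : ℂ))
    (bound := K.indicator fun _ => C) univ_mem
    (.of_forall fun s => (integrable_char_mul (integrable_slice hφ.continuous hc s)
      ξ).aestronglyMeasurable) (integrable_char_mul (integrable_slice hφ.continuous hc t) ξ)
    (integrable_char_mul (integrable_slice hφ'.continuous hc' t) ξ).aestronglyMeasurable
    (.of_forall fun x s _ => ?_) hint (.of_forall fun x s _ => ?_)).2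
  · refine (norm_char_mul (fun x => dirDeriv (1, 0) φ (s, x)) ξ x).trans_le ?_
    by_cases hx : x ∈ K
    · simpa [indicator_of_mem hx] using hC (s, x)
    · have : dirDeriv (1, 0) φ (s, x) = 0 := by
        by_contra h
        exact hx ⟨(s, x), subset_tsupport _ h, rfl⟩
      simp [indicator_of_notMem hx, this]
  · have h1 : HasDerivAt (fun s => φ (s, x)) (dirDeriv (1, 0) φ (s, x)) s :=
      (hφ.differentiable (by simp) (s, x)).hasFDerivAt.comp_hasDerivAt s
        ((hasDerivAt_id s).prodMk (hasDerivAt_const s x))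
    exact h1.ofReal_comp.const_mul _

/-- The adjoint heat operator `-∂ₜφ - Δφ`. -/
def adjointHeat (φ : ℝ × Space d → ℝ) (p : ℝ × Space d) : ℝ :=
  -dirDeriv (1, 0) φ p - ∑ i : Fin d, dirDeriv (0, EuclideanSpace.single i 1)
    (dirDeriv (0, EuclideanSpace.single i 1) φ) p

theorem continuous_adjointHeat {φ : ℝ × Space d → ℝ}
    (hφ : ContDiff ℝ ((⊤ : ℕ∞) : WithTop ℕ∞) φ) : Continuous (adjointHeat φ) :=
  (contDiff_dirDeriv hφ _).continuous.neg.sub (continuous_finsetSum _ fun _ _ =>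
    (contDiff_dirDeriv (contDiff_dirDeriv hφ _) _).continuous)

theorem hasCompactSupport_adjointHeat {φ : ℝ × Space d → ℝ} (hc : HasCompactSupport φ) :
    HasCompactSupport (adjointHeat φ) := by
  refine hc.mono' fun p hp => ?_
  by_contra h
  refine hp ?_
  have key : ∀ (v : ℝ × Space d) (ψ : ℝ × Space d → ℝ), p ∉ tsupport ψ →
      p ∉ tsupport (dirDeriv v ψ) := fun v ψ hψ hv => hψ (tsupport_fderiv_apply_subset ℝ v hv)
  simp [adjointHeat, image_eq_zero_of_notMem_tsupport (key _ _ h),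
    image_eq_zero_of_notMem_tsupport (key _ _ (key _ _ h))]

/-- The second derivatives contribute `(iξᵢ)²`, which sum to `-|ξ|²`. For each frequency the
backward heat operator thus becomes a first-order linear operator in time. -/
theorem spaceFourier_adjointHeat {φ : ℝ × Space d → ℝ}
    (hφ : ContDiff ℝ ((⊤ : ℕ∞) : WithTop ℕ∞) φ) (hc : HasCompactSupport φ) (p : ℝ × Space d) :
    spaceFourier (adjointHeat φ) p =
      -spaceFourier (dirDeriv (1, 0) φ) p + (‖p.2‖ ^ 2 : ℝ) * spaceFourier φ p := by
  have hi : ∀ i : Fin d, Integrable fun x => dirDeriv (0, EuclideanSpace.single i 1)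
      (dirDeriv (0, EuclideanSpace.single i 1) φ) (p.1, x) := fun i =>
    integrable_slice (contDiff_dirDeriv (contDiff_dirDeriv hφ _) _).continuous
      (hasCompactSupport_dirDeriv (hasCompactSupport_dirDeriv hc _) _) _
  have ht : Integrable fun x => dirDeriv (1, 0) φ (p.1, x) :=
    integrable_slice (contDiff_dirDeriv hφ _).continuous (hasCompactSupport_dirDeriv hc _) _
  have h1 : spaceFourier (adjointHeat φ) p = -spaceFourier (dirDeriv (1, 0) φ) p +
      -∑ i : Fin d, spaceFourier (dirDeriv (0, EuclideanSpace.single i 1)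
        (dirDeriv (0, EuclideanSpace.single i 1) φ)) p := by
    simp only [spaceFourier]
    rw [← fourier_sum _ fun i _ => hi i, ← fourier_neg, ← fourier_neg,
      ← fourier_add (χ := fun x => -dirDeriv (1, 0) φ (p.1, x)) ht.neg
        (η := fun x => -∑ i : Fin d, dirDeriv (0, EuclideanSpace.single i 1)
          (dirDeriv (0, EuclideanSpace.single i 1) φ) (p.1, x))
        (integrable_finsetSum _ fun i _ => hi i).neg]
    simp only [adjointHeat, sub_eq_add_neg]
  rw [h1, EuclideanSpace.norm_sq_eq]
  congr 1
  simp only [spaceFourier_dirDeriv_space (contDiff_dirDeriv hφ _) (hasCompactSupport_dirDeriv hc _),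
    spaceFourier_dirDeriv_space hφ hc, Complex.ofReal_sum, Finset.sum_mul]
  rw [← Finset.sum_neg_distrib]
  refine Finset.sum_congr rfl fun i _ => ?_
  simp only [EuclideanSpace.inner_single_right, Real.norm_eq_abs, sq_abs]
  simp only [one_mul, conj_trivial, Complex.ofReal_pow]
  ring_nf
  simp

/-- Duhamel's formula on the Fourier side. -/
theorem integral_adjointHeat_mul_exp {φ : ℝ × Space d → ℝ}
    (hφ : ContDiff ℝ ((⊤ : ℕ∞) : WithTop ℕ∞) φ) (hc : HasCompactSupport φ) {T : ℝ}
    (hT : ∀ x, φ (T, x) = 0) (s : ℝ) (ξ : Space d) :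
    ∫ t in s..T, spaceFourier (adjointHeat φ) (t, ξ) *
      (Real.exp (-(t - s) * ‖ξ‖ ^ 2) : ℝ) = spaceFourier φ (s, ξ) := by
  -- The exponential is the integrating factor, so the integrand is an exact derivative. The
  -- boundary term at `T` vanishes and the one at `s` is `φ̂(s,ξ)`.
  have hder : ∀ t, HasDerivAt (fun t => -(spaceFourier φ (t, ξ) *
      (Real.exp (-(t - s) * ‖ξ‖ ^ 2) : ℝ)))
      (spaceFourier (adjointHeat φ) (t, ξ) * (Real.exp (-(t - s) * ‖ξ‖ ^ 2) : ℝ)) t := fun t => by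
    have h1 : HasDerivAt (fun t : ℝ => -(t - s) * ‖ξ‖ ^ 2) (-‖ξ‖ ^ 2) t := by
      have := (((hasDerivAt_id t).sub_const s).neg).mul_const (‖ξ‖ ^ 2)
      convert! this using 1; ring
    convert! ((hasDerivAt_spaceFourier hφ hc t ξ).mul h1.exp.ofReal_comp).neg using 1
    rw [spaceFourier_adjointHeat hφ hc]
    push_cast; ring
  have hcont : Continuous fun t => spaceFourier (adjointHeat φ) (t, ξ) *
      ((Real.exp (-(t - s) * ‖ξ‖ ^ 2) : ℝ) : ℂ) := by
    refine Continuous.mul ?_ (by fun_prop)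
    simp only [spaceFourier_adjointHeat hφ hc]
    have h2 : ∀ ψ : ℝ × Space d → ℝ, ContDiff ℝ ((⊤ : ℕ∞) : WithTop ℕ∞) ψ → HasCompactSupport ψ →
        Continuous fun t => spaceFourier ψ (t, ξ) := fun ψ h h' =>
      continuous_iff_continuousAt.2 fun t => (hasDerivAt_spaceFourier h h' t ξ).continuousAt
    exact (h2 _ (contDiff_dirDeriv hφ _) (hasCompactSupport_dirDeriv hc _)).neg.add
      (continuous_const.mul (h2 _ hφ hc))
  rw [intervalIntegral.integral_eq_sub_of_hasDerivAt (fun t _ => hder t)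
    (hcont.intervalIntegrable _ _)]
  simp [spaceFourier, hT, fourier]

theorem integrable_adjointHeat_smul_heatFourier {φ : ℝ × Space d → ℝ}
    (hφ : ContDiff ℝ ((⊤ : ℕ∞) : WithTop ℕ∞) φ) (hc : HasCompactSupport φ) (p : ℝ × Space d) :
    Integrable (fun q : ℝ × Space d => adjointHeat φ q • heatFourier q.1 q.2 p)
      ((volume.restrict (Ioo 0 T)).prod volume) := by
  have hint0 : Integrable (adjointHeat φ) ((volume.restrict (Ioo 0 T)).prod volume) :=
    (continuous_adjointHeat hφ).integrable_of_hasCompactSupport (hasCompactSupport_adjointHeat hc)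
  refine hint0.norm.mono' (hint0.1.smul (stronglyMeasurable_heatFourier_uncurry.comp_measurable
    (g := fun q : ℝ × Space d => (q, p))
    (measurable_id.prodMk measurable_const)).aestronglyMeasurable) (.of_forall fun q => ?_)
  rw [norm_smul]
  refine mul_le_of_le_one_right (norm_nonneg _) ?_
  rw [norm_heatFourier]
  split_ifs with h
  · refine Real.exp_le_one_iff.2 ?_
    have : 0 ≤ (q.1 - p.1) * ‖p.2‖ ^ 2 := mul_nonneg (sub_nonneg.2 h.le) (sq_nonneg _)
    linarith
  · exact zero_le_one

/-- `φ̂` is the superposition of the representations of `u(t,x)` with weight `-∂ₜφ - Δφ`. -/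
theorem integral_adjointHeat_smul_heatFourier {φ : ℝ × Space d → ℝ}
    (hφ : ContDiff ℝ ((⊤ : ℕ∞) : WithTop ℕ∞) φ) (hc : HasCompactSupport φ) {T : ℝ}
    (hT : ∀ x, φ (T, x) = 0) {p : ℝ × Space d} (hp : p.1 ∈ Ioo 0 T) :
    ∫ q, adjointHeat φ q • heatFourier q.1 q.2 p ∂(volume.restrict (Ioo 0 T)).prod volume =
      spaceFourier φ p := by
  have h1 : ∀ t, ∫ x, adjointHeat φ (t, x) • heatFourier t x p =
      (Ioi p.1).indicator (fun t => spaceFourier (adjointHeat φ) (t, p.2) *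
        ((Real.exp (-(t - p.1) * ‖p.2‖ ^ 2) : ℝ) : ℂ)) t := fun t => by
    rw [indicator_apply]
    simp only [mem_Ioi]
    split_ifs with h
    · rw [spaceFourier, fourier_eq, ← integral_mul_const]
      refine integral_congr_ae (.of_forall fun x => ?_)
      simp only [heatFourier, if_pos h, Complex.real_smul]
      ring
    · simp [heatFourier, if_neg h]
  have h2 : Ioo 0 T ∩ Ioi p.1 = Ioo p.1 T := by
    ext s
    exact ⟨fun h => ⟨h.2, h.1.2⟩, fun h => ⟨⟨hp.1.trans h.1, h.2⟩, h.1⟩⟩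
  rw [integral_prod _ (integrable_adjointHeat_smul_heatFourier hφ hc p)]
  simp only [h1]
  rw [setIntegral_indicator measurableSet_Ioi, h2, ← integral_Ioc_eq_integral_Ioo,
    ← intervalIntegral.integral_of_le hp.2.le, integral_adjointHeat_mul_exp hφ hc hT]

theorem apply_eq_zero_of_notMem_Ioo (φ : 𝓓(region T d, ℝ)) {t : ℝ} (ht : t ∉ Ioo 0 T)
    (x : Space d) : φ (t, x) = 0 :=
  image_eq_zero_of_notMem_tsupport fun h => ht (φ.tsupport_subset h).1

/-- Test functions lie in the closed span of the representations of `u(t,x)`. -/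
theorem spectralRep_mem_closure_span [SFinite μ] (hμ : Integrable weight μ)
    (φ : 𝓓(region T d, ℝ)) :
    spectralRep hμ φ ∈ (Submodule.span ℝ (range fun q : Icc 0 T × Space d =>
      (memLp_heatFourier hμ q.1.2 q.2).toLp _)).topologicalClosure := by
  -- Passing to the double orthogonal complement leaves only a scalar Fubini argument, with no
  -- vector-valued integral of the `u(t,x)`.
  rw [← Submodule.orthogonal_orthogonal_eq_closure, Submodule.mem_orthogonal]
  intro h hh
  have horth : ∀ t (ht : t ∈ Icc 0 T) x,
      ∫ p, inner ℝ (h p) (heatFourier t x p) ∂spectralProd T μ = 0 := fun t ht x => by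
    have h1 := (Submodule.mem_orthogonal' _ _).1 hh _
      (Submodule.subset_span (mem_range_self (⟨⟨t, ht⟩, x⟩ : Icc 0 T × Space d)))
    rw [L2.inner_def] at h1
    rw [← h1]
    refine integral_congr_ae ?_
    filter_upwards [(memLp_heatFourier hμ ht x).coeFn_toLp] with p hp
    rw [hp]
  have hcont := continuous_adjointHeat φ.contDiff
  have hcs := hasCompactSupport_adjointHeat φ.hasCompactSupport
  set lam : Measure (ℝ × Space d) := (volume.restrict (Ioo 0 T)).prod volume
  have hint0 : Integrable (adjointHeat φ) lam := hcont.integrable_of_hasCompactSupport hcs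
  have hhm : StronglyMeasurable h := Lp.stronglyMeasurable h
  have hh2 := (memLp_two_iff_integrable_sq_norm hhm.aestronglyMeasurable).1 (Lp.memLp h)
  have hmeas : StronglyMeasurable fun z : (ℝ × Space d) × (ℝ × Space d) =>
      (adjointHeat φ z.1 * inner ℝ (h z.2) (heatFourier z.1.1 z.1.2 z.2) : ℝ) :=
    (hcont.comp continuous_fst).stronglyMeasurable.mul
      ((hhm.comp_measurable measurable_snd).inner stronglyMeasurable_heatFourier_uncurry)
  have hmemT : ∀ᵐ q ∂lam, q.1 ∈ Icc 0 T :=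
    Measure.quasiMeasurePreserving_fst.ae
      ((ae_restrict_mem measurableSet_Ioo).mono fun _ h => Ioo_subset_Icc_self h)
  have hinner : ∀ t (ht : t ∈ Icc 0 T) x,
      Integrable (fun p => ‖h p‖ ^ 2 + ‖heatFourier t x p‖ ^ 2) (spectralProd T μ) :=
    fun t ht x => hh2.add (integrable_norm_heatFourier_sq hμ ht x)
  have hle : ∀ q p : ℝ × Space d, ‖(inner ℝ (h p) (heatFourier q.1 q.2 p) : ℝ)‖ ≤
      ‖h p‖ ^ 2 + ‖heatFourier q.1 q.2 p‖ ^ 2 := fun q p => by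
    refine (norm_inner_le_norm _ _).trans ?_
    nlinarith [sq_nonneg (‖h p‖ - ‖heatFourier q.1 q.2 p‖), sq_nonneg ‖h p‖,
      sq_nonneg ‖heatFourier q.1 q.2 p‖]
  have hsec : ∀ q : ℝ × Space d, StronglyMeasurable fun p =>
      (inner ℝ (h p) (heatFourier q.1 q.2 p) : ℝ) :=
    fun q => hhm.inner (stronglyMeasurable_heatFourier q.1 q.2)
  have hint : Integrable (fun z : (ℝ × Space d) × (ℝ × Space d) =>
      (adjointHeat φ z.1 * inner ℝ (h z.2) (heatFourier z.1.1 z.1.2 z.2) : ℝ))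
      (lam.prod (spectralProd T μ)) := by
    rw [integrable_prod_iff hmeas.aestronglyMeasurable]
    constructor
    · filter_upwards [hmemT] with q hq
      exact ((hinner q.1 hq q.2).mono' (hsec q).aestronglyMeasurable
        (.of_forall (hle q))).const_mul _
    -- The inner `L¹` norm is bounded uniformly in `q` by the squared norm of `h` plus the uniform
    -- bound for `heatFourier`, so integrability of `adjointHeat φ` suffices.
    · refine (hint0.norm.mul_const (∫ p, ‖h p‖ ^ 2 ∂spectralProd T μ +
        (T + 1) * ∫ ξ, weight ξ ∂μ)).mono' hmeas.norm.integral_prod_right'.aestronglyMeasurable ?_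
      filter_upwards [hmemT] with q hq
      rw [Real.norm_of_nonneg (integral_nonneg fun p => norm_nonneg _)]
      simp only [norm_mul, integral_const_mul]
      refine mul_le_mul_of_nonneg_left ?_ (norm_nonneg _)
      calc ∫ p, ‖(inner ℝ (h p) (heatFourier q.1 q.2 p) : ℝ)‖ ∂spectralProd T μ
          ≤ ∫ p, (‖h p‖ ^ 2 + ‖heatFourier q.1 q.2 p‖ ^ 2) ∂spectralProd T μ :=
            integral_mono_of_nonneg (.of_forall fun p => norm_nonneg _) (hinner q.1 hq q.2)
              (.of_forall (hle q))
        _ ≤ _ := by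
            rw [integral_add hh2 (integrable_norm_heatFourier_sq hμ hq q.2)]
            gcongr
            exact integral_norm_heatFourier_sq_le_const hμ hq q.2
  rw [L2.inner_def]
  calc ∫ p, inner ℝ (h p) (spectralRep hμ φ p) ∂spectralProd T μ
      = ∫ p, ∫ q, (adjointHeat φ q * inner ℝ (h p) (heatFourier q.1 q.2 p) : ℝ) ∂lam
          ∂spectralProd T μ := by
        refine integral_congr_ae ?_
        filter_upwards [MemLp.coeFn_toLp (memLp_spaceFourier hμ (φ.contDiff.of_le
          (by exact_mod_cast le_top)) φ.hasCompactSupport), ae_spectralProd_fst_mem] with p h1 h2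
        rw [spectralRep, h1, ← integral_adjointHeat_smul_heatFourier φ.contDiff φ.hasCompactSupport
          (apply_eq_zero_of_notMem_Ioo φ (by simp)) h2, ← integral_inner
          (integrable_adjointHeat_smul_heatFourier φ.contDiff φ.hasCompactSupport p)]
        simp only [real_inner_smul_right]
        rfl
    _ = ∫ q, ∫ p, (adjointHeat φ q * inner ℝ (h p) (heatFourier q.1 q.2 p) : ℝ)
          ∂spectralProd T μ ∂lam := (integral_integral_swap hint).symm
    _ = 0 := by
        rw [← integral_zero (ℝ × Space d) ℝ (μ := lam)]
        refine integral_congr_ae ?_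
        filter_upwards [hmemT] with q hq
        rw [integral_const_mul, horth _ hq, mul_zero]

end Duality

/-! ### Transfer between the spectral space and `L₂(Ω)`. -/

section Main

variable {Ω : Type*} [MeasurableSpace Ω] {P : Measure Ω} {d : ℕ} {T : ℝ} {κ : Kernel d}
  {μ : Measure (Space d)} {F : 𝓓(region T d, ℝ) → Ω → ℝ}

theorem inner_spectralRep [SFinite μ] (hκ : IsSpectralMeasure κ μ) (hμ : Integrable weight μ)
    (hF : IsGaussianNoise T κ P F) (φ ψ : 𝓓(region T d, ℝ)) :
    inner ℝ (spectralRep hμ φ) (spectralRep hμ ψ) = inner ℝ (hF.toL2 φ) (hF.toL2 ψ) := by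
  rw [spectralRep, spectralRep, ← covariance_eq_inner hκ, ← hF.covariance φ ψ,
    IsGaussianNoise.toL2, IsGaussianNoise.toL2, inner_toLp_toLp]
  refine integral_congr_ae (.of_forall fun ω => ?_)
  simp [mul_comm]

/-- `u(t,x)` is the limit of `F(ψ)` along test functions approximating the heat kernel. -/
theorem exists_seq_tendsto_processSolution [SFinite μ] (hκ : IsSpectralMeasure κ μ)
    (hμ : Integrable weight μ) (hF : IsGaussianNoise T κ P F) {t : ℝ} (ht : t ∈ Icc 0 T)
    (x : Space d) :
    ∃ u : ℕ → 𝓓(region T d, ℝ),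
      Tendsto (fun n => spectralRep hμ (u n)) atTop (𝓝 ((memLp_heatFourier hμ ht x).toLp _)) ∧
      Tendsto (fun n => hF.toL2 (u n)) atTop (𝓝 (processSolution hF μ t x)) := by
  refine exists_seq_tendsto_limUnder_of_gram (inner_spectralRep hκ hμ hF)
    (heatFourier_mem_closure hμ ht x) fun ψ => ?_
  rw [spectralRep, ← distSq_eq_edist_sq, ← spaceFourier_heatKernel]
  rfl

/-- The noise and the solution as one family in `L₂(Ω)`. -/
def noiseAndSolution (hF : IsGaussianNoise T κ P F) (μ : Measure (Space d)) :
    𝓓(region T d, ℝ) ⊕ (Icc 0 T × Space d) → Lp ℝ 2 P :=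
  Sum.elim hF.toL2 fun q => processSolution hF μ q.1 q.2

/-- The spectral representation of the noise and the solution. -/
def spectralNoiseAndSolution [SFinite μ] (hμ : Integrable weight μ) :
    𝓓(region T d, ℝ) ⊕ (Icc 0 T × Space d) → Lp ℂ 2 (spectralProd T μ) :=
  Sum.elim (spectralRep hμ) fun q => (memLp_heatFourier hμ q.1.2 q.2).toLp _

theorem exists_seq_tendsto_noiseAndSolution [SFinite μ] (hκ : IsSpectralMeasure κ μ)
    (hμ : Integrable weight μ) (hF : IsGaussianNoise T κ P F)
    (i : 𝓓(region T d, ℝ) ⊕ (Icc 0 T × Space d)) :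
    ∃ u : ℕ → 𝓓(region T d, ℝ),
      Tendsto (fun n => spectralRep hμ (u n)) atTop (𝓝 (spectralNoiseAndSolution hμ i)) ∧
      Tendsto (fun n => hF.toL2 (u n)) atTop (𝓝 (noiseAndSolution hF μ i)) := by
  rcases i with φ | q
  · exact ⟨fun _ => φ, tendsto_const_nhds, tendsto_const_nhds⟩
  · exact exists_seq_tendsto_processSolution hκ hμ hF q.1.2 q.2

/-- One sequence of test functions approximates both versions of each vector, so the isometry on
test functions passes to the limit. -/
theorem inner_spectralNoiseAndSolution [SFinite μ] (hκ : IsSpectralMeasure κ μ)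
    (hμ : Integrable weight μ) (hF : IsGaussianNoise T κ P F)
    (i j : 𝓓(region T d, ℝ) ⊕ (Icc 0 T × Space d)) :
    inner ℝ (spectralNoiseAndSolution hμ i) (spectralNoiseAndSolution hμ j) =
      inner ℝ (noiseAndSolution hF μ i) (noiseAndSolution hF μ j) := by
  obtain ⟨u, hu1, hu2⟩ := exists_seq_tendsto_noiseAndSolution hκ hμ hF i
  obtain ⟨v, hv1, hv2⟩ := exists_seq_tendsto_noiseAndSolution hκ hμ hF j
  refine tendsto_nhds_unique (hu1.inner hv1) ?_
  simpa only [inner_spectralRep hκ hμ hF] using hu2.inner hv2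

end Main

end StochHeat

end

theorem lemma3p3 {Ω : Type*} [MeasurableSpace Ω] (P : Measure Ω) [IsProbabilityMeasure P]
    (d : ℕ) (T : ℝ) (hT : 0 < T)
    (κ : StochHeat.Kernel d) (μ : Measure (StochHeat.Space d))
    (hκ : StochHeat.IsSpectralMeasure κ μ)
    (hμ : Integrable (fun ξ : StochHeat.Space d => 1 / (1 + ‖ξ‖ ^ 2)) μ)
    (F : 𝓓(StochHeat.region T d, ℝ) → Ω → ℝ)
    (hF : StochHeat.IsGaussianNoise T κ P F) :
    StochHeat.solutionGaussianSpace hF μ = StochHeat.noiseGaussianSpace hF := by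
  have hw : Integrable StochHeat.weight μ := hμ
  have := StochHeat.sigmaFinite_of_integrable_weight hw
  have hgram := StochHeat.inner_spectralNoiseAndSolution hκ hw hF
  have hu : {Y | ∃ t ∈ Icc 0 T, ∃ x, Y = StochHeat.processSolution hF μ t x} =
      StochHeat.noiseAndSolution hF μ '' range Sum.inr := by
    ext Y
    constructor
    · rintro ⟨t, ht, x, rfl⟩
      exact ⟨_, ⟨(⟨t, ht⟩, x), rfl⟩, rfl⟩
    · rintro ⟨_, ⟨q, rfl⟩, rfl⟩
      exact ⟨q.1, q.1.2, q.2, rfl⟩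
  have hn : range hF.toL2 = StochHeat.noiseAndSolution hF μ '' range Sum.inl := by
    rw [← range_comp]; rfl
  rw [StochHeat.solutionGaussianSpace, StochHeat.noiseGaussianSpace, hu, hn]
  -- Each inclusion is checked on generators, and `hgram` moves each check to the spectral side.
  refine le_antisymm (Submodule.topologicalClosure_minimal _ (Submodule.span_le.2 ?_)
    (Submodule.isClosed_topologicalClosure _)) (Submodule.topologicalClosure_minimal _
    (Submodule.span_le.2 ?_) (Submodule.isClosed_topologicalClosure _))
  · rintro _ ⟨_, ⟨q, rfl⟩, rfl⟩
    refine StochHeat.mem_closure_span_of_gram hgram ?_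
    rw [← range_comp]
    exact closure_mono Submodule.subset_span (StochHeat.heatFourier_mem_closure hw q.1.2 q.2)
  · rintro _ ⟨_, ⟨φ, rfl⟩, rfl⟩
    refine StochHeat.mem_closure_span_of_gram hgram ?_
    rw [← range_comp]
    exact StochHeat.spectralRep_mem_closure_span hw φ
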